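/- For a finite simple graph $G$ let $C(G)=\sum_i\sum_{j\ne i}2^{-d(i,j)}$ be its closeness, where $i,j$ range over the vertices, $d$ is the graph distance, and $2^{-\infty}=0$. Its link residual closeness is $R(G)=\min_e C(G-e)$, the minimum being over the edges $e$ of $G$. For $1\le m<n$ let $H_{2m+1,2n+1}$ be the Harary graph with vertices $1,2,\dots,2n+1$ placed on a circle in this order, in which every vertex is joined to the nearest $m$ vertices in each direction and, in addition, $i$ is joined to $i+n$ for $1\le i\le n+1$. Let $m>2$ and suppose that $p=\left\lfloor\frac{n+m-1}{2m}\right\rfloor>1$. Then $$R(H_{2m+1,2n+1})=C(H_{2m+1,2n+1})-4+(3p+4)2^{-p},$$ and the minimum that defines $R(H_{2m+1,2n+1})$ is attained by deleting the edge $(n,n+m)$. -/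

import Mathlib

/-- Contribution `2^{-d(i,j)}` of an ordered pair of vertices; it is `0` when `i` and `j` lie in
different components (infinite distance). -/
noncomputable def pairCloseness {V : Type*} (G : SimpleGraph V) (i j : V) : ℝ :=
  open Classical in if G.Reachable i j then (2 : ℝ) ^ (-(G.dist i j : ℤ)) else 0

/-- The closeness `C(G) = ∑_i ∑_{j ≠ i} 2^{-d(i,j)}` of a finite simple graph. -/
noncomputable def closeness {V : Type*} [Fintype V] [DecidableEq V] (G : SimpleGraph V) : ℝ :=
  ∑ i : V, ∑ j ∈ Finset.univ.erase i, pairCloseness G i j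

/-- The closenesses of all graphs obtained from `G` by removing exactly one of its links. -/
def linkDeletedClosenesses {V : Type*} [Fintype V] [DecidableEq V] (G : SimpleGraph V) : Set ℝ :=
  {c | ∃ e ∈ G.edgeSet, c = closeness (G.deleteEdges {e})}

/-- The link residual closeness `R(G)`: the minimum, over the links of `G`, of the closeness of the
graph with that link removed (a finite set of reals, so that the infimum is a minimum as soon as
`G` has a link). -/
noncomputable def linkResidualCloseness {V : Type*} [Fintype V] [DecidableEq V]
    (G : SimpleGraph V) : ℝ :=
  sInf (linkDeletedClosenesses G)

/-- The infimum in the definition of `R(G)` is a minimum for every graph with at least one link. -/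
theorem isLeast_linkResidualCloseness {V : Type*} [Fintype V] [DecidableEq V]
    (G : SimpleGraph V) (h : G.edgeSet.Nonempty) :
    IsLeast (linkDeletedClosenesses G) (linkResidualCloseness G) := by
  have hfin : (linkDeletedClosenesses G).Finite := by
    refine (Set.toFinite ((fun e => closeness (G.deleteEdges {e})) '' G.edgeSet)).subset ?_
    rintro c ⟨e, he, rfl⟩
    exact ⟨e, he, rfl⟩
  obtain ⟨e, he⟩ := h
  exact ⟨Set.Nonempty.csInf_mem ⟨_, e, he, rfl⟩ hfin, fun c hc => csInf_le hfin.bddBelow hc⟩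

/-- The name of a vertex on the circle: the vertices are named `1, 2, …, N` in cyclic order. -/
def vertexLabel {N : ℕ} (i : Fin N) : ℕ := i.val + 1

/-- The number of steps between two vertices along the shorter arc of the circle. -/
def circleDist {N : ℕ} (i j : Fin N) : ℕ :=
  min (Nat.dist (vertexLabel i) (vertexLabel j)) (N - Nat.dist (vertexLabel i) (vertexLabel j))

/-- The Harary graph `H_{k,N}` (for `2 ≤ k < N`). Every vertex is linked to the nearest `⌊k/2⌋`
vertices in each direction; if `k` is odd, the links `(i, i + ⌊N/2⌋)` are added for all `i` such
that both `i` and `i + ⌊N/2⌋` are in `{1, …, N}`. For `N = 2q` these are the `q` diameters, for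
`N = 2q + 1` they are the links `(i, i + q)` with `i ∈ [1, q + 1]`. -/
def hararyGraph (k N : ℕ) : SimpleGraph (Fin N) where
  Adj i j := i ≠ j ∧ (circleDist i j ≤ k / 2 ∨
    (Odd k ∧ (vertexLabel i + N / 2 = vertexLabel j ∨ vertexLabel j + N / 2 = vertexLabel i)))
  symm := ⟨by
    rintro i j ⟨hne, h⟩
    refine ⟨hne.symm, ?_⟩
    rcases h with h | ⟨hk, h⟩
    · left
      simpa only [circleDist, Nat.dist_comm] using h
    · exact Or.inr ⟨hk, h.symm⟩⟩
  loopless := ⟨fun i h => h.1 rfl⟩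

/-!
Removing a link changes the distance of a pair only if every shortest path of the pair uses the
link. Grouping these dependent pairs by the number `k` of other links on such a path turns the loss
of closeness into a sum over `k`.

For a link `(u, u + r)` of the circle, the parts of a dependent path before and after the link
either run along the circle or use the long link at that end of `(u, u + r)`, and at most one of
them does the latter. As every step along the circle must be as long as possible, there are at most
`k + 1` pairs on the circle and at most `k` in each of the two families with a long link, and each
pair gets farther by exactly one. For `k < p` this gives at most `3 * k + 1` unordered pairs, which
contribute `2 * ∑_{k < p} (3 * k + 1) * 2^{-(k + 2)} = 4 - (3 * p + 4) * 2^{-p}`. Pairs with `k = p`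
occur only where one of the two families is missing, and do not make up for it. A long link serves
so few pairs that it stays below this value, while a link of length `m` that straddles the vertex
with two long links reaches it.
-/

section WithinDist

variable {V : Type*} {G H : SimpleGraph V} {k l : ℕ} {u v x y z : V}

/-- Two vertices are joined by a walk of at most `k` links. This is the form in which all distance
bounds are stated, since it needs no connectedness assumption. -/
def WithinDist (G : SimpleGraph V) (k : ℕ) (x y : V) : Prop := G.edist x y ≤ k

namespace WithinDist

theorem refl (G : SimpleGraph V) (k : ℕ) (x : V) : WithinDist G k x x := by
  simp [WithinDist]

theorem symm (h : WithinDist G k x y) : WithinDist G k y x := by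
  rwa [WithinDist, SimpleGraph.edist_comm]

theorem trans (h : WithinDist G k x y) (h' : WithinDist G l y z) : WithinDist G (k + l) x z := by
  rw [WithinDist, Nat.cast_add]
  exact SimpleGraph.edist_triangle.trans (add_le_add h h')

theorem mono (h : WithinDist G k x y) (hkl : k ≤ l) : WithinDist G l x y :=
  le_trans h (by exact_mod_cast hkl)

theorem of_walk (w : G.Walk x y) (hw : w.length ≤ k) : WithinDist G k x y :=
  w.edist_le.trans (by exact_mod_cast hw)

theorem exists_walk (h : WithinDist G k x y) : ∃ w : G.Walk x y, w.length ≤ k := by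
  obtain ⟨w, hw⟩ := SimpleGraph.exists_walk_of_edist_ne_top (ne_top_of_le_ne_top (by simp) h)
  exact ⟨w, by rw [WithinDist, ← hw] at h; exact_mod_cast h⟩

theorem reachable (h : WithinDist G k x y) : G.Reachable x y :=
  h.exists_walk.elim fun w _ => ⟨w⟩

theorem of_adj (h : G.Adj x y) : WithinDist G 1 x y :=
  of_walk h.toWalk (by simp)

theorem dist_le (h : WithinDist G k x y) : G.dist x y ≤ k := by
  obtain ⟨w, hw⟩ := h.exists_walk
  exact (SimpleGraph.dist_le w).trans hw

theorem of_reachable (h : G.Reachable x y) : WithinDist G (G.dist x y) x y := by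
  obtain ⟨w, hw⟩ := h.exists_walk_length_eq_dist
  exact of_walk w hw.le

theorem mono_graph (hHG : H ≤ G) (h : WithinDist H k x y) : WithinDist G k x y :=
  le_trans (SimpleGraph.edist_anti hHG) h

theorem map {V' : Type*} {G' : SimpleGraph V'} (φ : G →g G') (h : WithinDist G k x y) :
    WithinDist G' k (φ x) (φ y) := by
  obtain ⟨w, hw⟩ := h.exists_walk
  exact of_walk (w.map φ) (by simpa using hw)

theorem map_iso {V' : Type*} {G' : SimpleGraph V'} (φ : G ≃g G') :
    WithinDist G' k (φ x) (φ y) ↔ WithinDist G k x y :=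
  ⟨fun h => by simpa using h.map φ.symm.toHom, fun h => h.map φ.toHom⟩

theorem eq_of_zero (h : WithinDist G 0 x y) : x = y := by
  obtain ⟨w, hw⟩ := h.exists_walk
  exact w.eq_of_length_eq_zero (Nat.le_zero.mp hw)

theorem cases_last (h : WithinDist G (k + 1) x y) :
    WithinDist G k x y ∨ ∃ z, WithinDist G k x z ∧ G.Adj z y := by
  obtain ⟨w, hw⟩ := h.exists_walk
  induction w using SimpleGraph.Walk.concatRec with
  | Hnil => exact Or.inl (refl G k _)
  | Hconcat w hzy _ =>
    rw [SimpleGraph.Walk.length_concat] at hw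
    exact Or.inr ⟨_, of_walk w (by omega), hzy⟩

end WithinDist

end WithinDist

section PairCloseness

variable {V : Type*} {G : SimpleGraph V} {k : ℕ} {x y : V}

theorem pairCloseness_self (G : SimpleGraph V) (x : V) : pairCloseness G x x = 1 := by
  simp [pairCloseness]

theorem pairCloseness_comm (G : SimpleGraph V) (x y : V) :
    pairCloseness G x y = pairCloseness G y x := by
  unfold pairCloseness
  rw [SimpleGraph.dist_comm, SimpleGraph.reachable_comm]

theorem pairCloseness_of_reachable (h : G.Reachable x y) :
    pairCloseness G x y = (1 / 2 : ℝ) ^ G.dist x y := by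
  simp [pairCloseness, if_pos h, zpow_neg]

theorem pairCloseness_nonneg (G : SimpleGraph V) (x y : V) : 0 ≤ pairCloseness G x y := by
  unfold pairCloseness
  split_ifs <;> positivity

theorem half_pow_le_pairCloseness (h : WithinDist G k x y) :
    (1 / 2 : ℝ) ^ k ≤ pairCloseness G x y := by
  rw [pairCloseness_of_reachable h.reachable]
  exact pow_le_pow_of_le_one (by norm_num) (by norm_num) h.dist_le

theorem pairCloseness_le_half_pow (h : ¬ WithinDist G k x y) :
    pairCloseness G x y ≤ (1 / 2 : ℝ) ^ (k + 1) := by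
  by_cases hr : G.Reachable x y
  · rw [pairCloseness_of_reachable hr]
    refine pow_le_pow_of_le_one (by norm_num) (by norm_num) ?_
    exact Nat.lt_of_not_le (mt (WithinDist.of_reachable hr).mono h)
  · rw [pairCloseness, if_neg hr]
    positivity

theorem pairCloseness_eq_half_pow (h : ¬ WithinDist G k x y) (h' : WithinDist G (k + 1) x y) :
    pairCloseness G x y = (1 / 2 : ℝ) ^ (k + 1) :=
  (pairCloseness_le_half_pow h).antisymm (half_pow_le_pairCloseness h')

theorem pairCloseness_mono {H : SimpleGraph V} (hHG : H ≤ G) (x y : V) :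
    pairCloseness H x y ≤ pairCloseness G x y := by
  by_cases hr : H.Reachable x y
  · rw [pairCloseness_of_reachable hr]
    exact half_pow_le_pairCloseness ((WithinDist.of_reachable hr).mono_graph hHG)
  · rw [pairCloseness, if_neg hr]
    exact pairCloseness_nonneg G x y

theorem closeness_eq_sum_sub_card [Fintype V] [DecidableEq V] (G : SimpleGraph V) :
    closeness G = ∑ q : V × V, pairCloseness G q.1 q.2 - Fintype.card V := by
  have hrow (x : V) : ∑ y ∈ Finset.univ.erase x, pairCloseness G x y =
      ∑ y, pairCloseness G x y - 1 := by
    rw [Finset.sum_erase_eq_sub (Finset.mem_univ x), pairCloseness_self]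
  simp [closeness, hrow, Fintype.sum_prod_type]

end PairCloseness

section LinkLoss

variable {V : Type*} {G : SimpleGraph V} {k a b a' b' D L : ℕ} {u v x y : V}

/-- The graph `G` with the link `(u, v)` removed. -/
abbrev deleteLink (G : SimpleGraph V) (u v : V) : SimpleGraph V := G.deleteEdges {s(u, v)}

/-- What the pair `q` loses in closeness when the link `(u, v)` is removed. -/
noncomputable def linkLoss (G : SimpleGraph V) (u v : V) (q : V × V) : ℝ :=
  pairCloseness G q.1 q.2 - pairCloseness (deleteLink G u v) q.1 q.2

/-- The shortest path from `x` to `y` must use the link `(u, v)`, in this direction, after `a` and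
before `b` other links: removing the link makes `x` and `y` more distant. -/
structure LinkDependent (G : SimpleGraph V) (u v : V) (a b : ℕ) (x y : V) : Prop where
  near : WithinDist (deleteLink G u v) a x u
  far : WithinDist (deleteLink G u v) b v y
  not_withinDist : ¬ WithinDist G (a + b) x y
  not_withinDist_deleteLink : ¬ WithinDist (deleteLink G u v) (a + b + 1) x y

theorem deleteLink_comm (G : SimpleGraph V) (u v : V) : deleteLink G u v = deleteLink G v u := by
  rw [deleteLink, Sym2.eq_swap]

theorem deleteLink_adj : (deleteLink G u v).Adj x y ↔ G.Adj x y ∧ s(x, y) ≠ s(u, v) := by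
  simp [SimpleGraph.deleteEdges_adj]

theorem deleteLink_le (G : SimpleGraph V) (u v : V) : deleteLink G u v ≤ G :=
  SimpleGraph.deleteEdges_le _

/-- The restriction of a graph isomorphism to the graphs with a link and its image removed. -/
def deleteLinkIso {V' : Type*} {G' : SimpleGraph V'} (φ : G ≃g G') (u v : V) :
    deleteLink G u v ≃g deleteLink G' (φ u) (φ v) where
  toEquiv := φ.toEquiv
  map_rel_iff' := by simp [φ.map_adj_iff]

theorem linkLoss_nonneg (G : SimpleGraph V) (u v : V) (q : V × V) : 0 ≤ linkLoss G u v q :=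
  sub_nonneg.mpr (pairCloseness_mono (deleteLink_le G u v) _ _)

theorem linkLoss_swap (G : SimpleGraph V) (u v : V) (q : V × V) :
    linkLoss G u v q.swap = linkLoss G u v q := by
  simp only [linkLoss, Prod.fst_swap, Prod.snd_swap, pairCloseness_comm _ q.2]

theorem closeness_sub_closeness_deleteLink [Fintype V] [DecidableEq V] (G : SimpleGraph V)
    (u v : V) : closeness G - closeness (deleteLink G u v) = ∑ q, linkLoss G u v q := by
  simp only [linkLoss, closeness_eq_sum_sub_card, Finset.sum_sub_distrib]
  ring

theorem WithinDist.split_at_link (h : WithinDist G k x y) :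
    WithinDist (deleteLink G u v) k x y ∨ ∃ a b, a + b + 1 ≤ k ∧
      (WithinDist (deleteLink G u v) a x u ∧ WithinDist (deleteLink G u v) b v y ∨
        WithinDist (deleteLink G u v) a x v ∧ WithinDist (deleteLink G u v) b u y) := by
  induction k generalizing y with
  | zero => exact Or.inl (h.eq_of_zero ▸ refl _ 0 x)
  | succ k ih =>
    rcases h.cases_last with h | ⟨z, hxz, hzy⟩
    · rcases ih h with h | ⟨a, b, hab, h⟩
      · exact Or.inl (h.mono (by omega))
      · exact Or.inr ⟨a, b, by omega, h⟩
    by_cases he : s(z, y) = s(u, v)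
    · rcases Sym2.eq_iff.mp he with ⟨rfl, rfl⟩ | ⟨rfl, rfl⟩ <;>
        rcases ih hxz with h | ⟨a, b, hab, ⟨h, -⟩ | ⟨h, -⟩⟩
      · exact Or.inr ⟨k, 0, by omega, Or.inl ⟨h, refl _ 0 _⟩⟩
      · exact Or.inr ⟨a, 0, by omega, Or.inl ⟨h, refl _ 0 _⟩⟩
      · exact Or.inl (h.mono (by omega))
      · exact Or.inr ⟨k, 0, by omega, Or.inr ⟨h, refl _ 0 _⟩⟩
      · exact Or.inl (h.mono (by omega))
      · exact Or.inr ⟨a, 0, by omega, Or.inr ⟨h, refl _ 0 _⟩⟩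
    · have hlast := of_adj (deleteLink_adj.mpr ⟨hzy, he⟩)
      rcases ih hxz with h | ⟨a, b, hab, ⟨h, h'⟩ | ⟨h, h'⟩⟩
      · exact Or.inl (h.trans hlast)
      · exact Or.inr ⟨a, b + 1, by omega, Or.inl ⟨h, h'.trans hlast⟩⟩
      · exact Or.inr ⟨a, b + 1, by omega, Or.inr ⟨h, h'.trans hlast⟩⟩

namespace LinkDependent

theorem swap (h : LinkDependent G u v a b x y) : LinkDependent G v u b a y x where
  near := deleteLink_comm G u v ▸ h.far.symm
  far := deleteLink_comm G u v ▸ h.near.symm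
  not_withinDist h' := h.not_withinDist (by simpa only [add_comm] using h'.symm)
  not_withinDist_deleteLink h' := h.not_withinDist_deleteLink
    (by simpa only [deleteLink_comm G u v, add_comm] using h'.symm)

theorem not_withinDist_near (h : LinkDependent G u v a b x y) :
    ¬ WithinDist (deleteLink G u v) (a + 1) x v := fun hxv =>
  h.not_withinDist_deleteLink ((hxv.trans h.far).mono (by omega))

theorem map_iso {V' : Type*} {G' : SimpleGraph V'} (φ : G ≃g G') :
    LinkDependent G' (φ u) (φ v) a b (φ x) (φ y) ↔ LinkDependent G u v a b x y := by
  have hcut {k : ℕ} {x y : V} : WithinDist (deleteLink G' (φ u) (φ v)) k (φ x) (φ y) ↔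
      WithinDist (deleteLink G u v) k x y :=
    WithinDist.map_iso (deleteLinkIso φ u v)
  constructor
  · rintro ⟨h₁, h₂, h₃, h₄⟩
    exact ⟨hcut.mp h₁, hcut.mp h₂, mt (WithinDist.map_iso φ).mpr h₃, mt hcut.mpr h₄⟩
  · rintro ⟨h₁, h₂, h₃, h₄⟩
    exact ⟨hcut.mpr h₁, hcut.mpr h₂, mt (WithinDist.map_iso φ).mp h₃, mt hcut.mp h₄⟩

theorem withinDist (huv : G.Adj u v) (h : LinkDependent G u v a b x y) :
    WithinDist G (a + b + 1) x y :=
  (((h.near.mono_graph (deleteLink_le ..)).trans (.of_adj huv)).trans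
    (h.far.mono_graph (deleteLink_le ..))).mono (by omega)

theorem ne_of_pos (huv : G.Adj u v) (h : LinkDependent G u v a b x y) (ha : 0 < a) : x ≠ u := by
  rintro rfl
  exact h.not_withinDist
    (((WithinDist.of_adj huv).trans (h.far.mono_graph (deleteLink_le ..))).mono (by omega))

theorem add_eq_add (huv : G.Adj u v) (h : LinkDependent G u v a b x y)
    (h' : LinkDependent G u v a' b' x y) : a + b = a' + b' := by
  by_contra hne
  rcases Nat.lt_or_gt_of_ne hne with hlt | hlt
  · exact h'.not_withinDist ((h.withinDist huv).mono hlt)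
  · exact h.not_withinDist ((h'.withinDist huv).mono hlt)

theorem not_linkDependent_swap (h : LinkDependent G u v a b x y) :
    ¬ LinkDependent G u v a' b' y x := by
  intro h'
  have hlt {a b a' b' : ℕ} {x y : V} (h : LinkDependent G u v a b x y)
      (h' : LinkDependent G u v a' b' y x) : a + b < a' + b' := by
    have hu := mt (h.near.trans h'.near.symm).mono h.not_withinDist_deleteLink
    have hv := mt (h'.far.symm.trans h.far).mono h.not_withinDist_deleteLink
    omega
  exact lt_asymm (hlt h h') (hlt h' h)

end LinkDependent

theorem exists_linkDependent (huv : G.Adj u v) (hxy : WithinDist G D x y)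
    (hloss : linkLoss G u v (x, y) ≠ 0) :
    ∃ a b, a + b < D ∧ (LinkDependent G u v a b x y ∨ LinkDependent G u v a b y x) := by
  have hcut : ¬ WithinDist (deleteLink G u v) (G.dist x y) x y := by
    intro hcut
    refine hloss ((linkLoss_nonneg G u v _).antisymm' (sub_nonpos.mpr ?_))
    rw [pairCloseness_of_reachable hxy.reachable]
    exact half_pow_le_pairCloseness hcut
  have hle : deleteLink G u v ≤ G := deleteLink_le G u v
  rcases (WithinDist.of_reachable hxy.reachable).split_at_link with h | ⟨a, b, hab, h⟩
  · exact absurd h hcut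
  have hthrough : WithinDist G (a + 1 + b) x y := by
    rcases h with ⟨hx, hy⟩ | ⟨hx, hy⟩
    · exact ((hx.mono_graph hle).trans (.of_adj huv)).trans (hy.mono_graph hle)
    · exact ((hx.mono_graph hle).trans (.of_adj huv.symm)).trans (hy.mono_graph hle)
  have hdist : G.dist x y = a + b + 1 := by linarith [hthrough.dist_le]
  have hmin : ¬ WithinDist G (a + b) x y := fun h => by linarith [h.dist_le]
  rw [hdist] at hcut
  have hD := hxy.dist_le
  rcases h with ⟨hx, hy⟩ | ⟨hx, hy⟩
  · exact ⟨a, b, by omega, Or.inl ⟨hx, hy, hmin, hcut⟩⟩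
  · refine ⟨b, a, by omega, Or.inr (LinkDependent.swap ⟨?_, ?_, hmin, ?_⟩)⟩ <;>
      rwa [deleteLink_comm]

section Fintype

variable [Fintype V]

open Classical in
/-- The ordered pairs that depend on the link `(u, v)`, in this direction, and are joined through
it by shortest paths with `k` other links. -/
noncomputable def dependentPairs (G : SimpleGraph V) (u v : V) (k : ℕ) : Finset (V × V) :=
  {q | ∃ a b, a + b = k ∧ LinkDependent G u v a b q.1 q.2}

theorem mem_dependentPairs :
    (x, y) ∈ dependentPairs G u v k ↔ ∃ a b, a + b = k ∧ LinkDependent G u v a b x y := by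
  simp [dependentPairs]

theorem pairwise_disjoint_dependentPairs (huv : G.Adj u v) :
    Pairwise (Function.onFun Disjoint (dependentPairs G u v)) := by
  intro k l hkl
  rw [Function.onFun, Finset.disjoint_left]
  rintro ⟨x, y⟩ hk hl
  obtain ⟨a, b, rfl, hab⟩ := mem_dependentPairs.mp hk
  obtain ⟨a', b', rfl, hab'⟩ := mem_dependentPairs.mp hl
  exact hkl (hab.add_eq_add huv hab')

theorem sum_linkLoss_eq (huv : G.Adj u v) (hD : ∀ x y, WithinDist G D x y) :
    ∑ q, linkLoss G u v q =
      2 * ∑ k ∈ Finset.range D, ∑ q ∈ dependentPairs G u v k, linkLoss G u v q := by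
  classical
  set A := (Finset.range D).biUnion (dependentPairs G u v) with hA
  have hmemA {x y : V} (h : (x, y) ∈ A) : ∃ a b, LinkDependent G u v a b x y := by
    obtain ⟨k, -, h⟩ := Finset.mem_biUnion.mp h
    obtain ⟨a, b, -, h⟩ := mem_dependentPairs.mp h
    exact ⟨a, b, h⟩
  have hdisj : Disjoint A (A.image Prod.swap) := by
    rw [Finset.disjoint_left]
    rintro ⟨x, y⟩ hxy himage
    obtain ⟨⟨y', x'⟩, hyx, heq⟩ := Finset.mem_image.mp himage
    obtain ⟨rfl, rfl⟩ := Prod.mk.inj heq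
    obtain ⟨a, b, hab⟩ := hmemA hxy
    obtain ⟨a', b', hab'⟩ := hmemA hyx
    exact hab.not_linkDependent_swap hab'
  have hsupport : ∀ q ∉ A ∪ A.image Prod.swap, linkLoss G u v q = 0 := by
    rintro ⟨x, y⟩ hq
    contrapose! hq
    obtain ⟨a, b, hab, h | h⟩ := exists_linkDependent huv (hD x y) hq
    · exact Finset.mem_union_left _ (Finset.mem_biUnion.mpr
        ⟨a + b, Finset.mem_range.mpr hab, mem_dependentPairs.mpr ⟨a, b, rfl, h⟩⟩)
    · exact Finset.mem_union_right _ (Finset.mem_image.mpr ⟨(y, x), Finset.mem_biUnion.mpr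
        ⟨a + b, Finset.mem_range.mpr hab, mem_dependentPairs.mpr ⟨a, b, rfl, h⟩⟩, rfl⟩)
  rw [← Finset.sum_subset (Finset.subset_univ _) fun q _ hq => hsupport q hq,
    Finset.sum_union hdisj, Finset.sum_image Prod.swap_injective.injOn, two_mul,
    ← Finset.sum_biUnion ((pairwise_disjoint_dependentPairs huv).set_pairwise _)]
  simp only [linkLoss_swap, hA]

theorem linkLoss_le (hL : WithinDist (deleteLink G u v) L u v) {q : V × V}
    (hq : q ∈ dependentPairs G u v k) :
    linkLoss G u v q ≤ (1 / 2) ^ (k + 1) - (1 / 2) ^ (k + L) := by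
  obtain ⟨a, b, rfl, h⟩ := mem_dependentPairs.mp hq
  have hcut : WithinDist (deleteLink G u v) (a + b + L) q.1 q.2 :=
    ((h.near.trans hL).trans h.far).mono (by omega)
  exact sub_le_sub (pairCloseness_le_half_pow h.not_withinDist) (half_pow_le_pairCloseness hcut)

theorem linkLoss_eq (huv : G.Adj u v) (hL : WithinDist (deleteLink G u v) 2 u v) {q : V × V}
    (hq : q ∈ dependentPairs G u v k) : linkLoss G u v q = (1 / 2) ^ (k + 2) := by
  obtain ⟨a, b, rfl, h⟩ := mem_dependentPairs.mp hq
  have hcut : WithinDist (deleteLink G u v) (a + b + 1 + 1) q.1 q.2 :=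
    ((h.near.trans hL).trans h.far).mono (by omega)
  rw [linkLoss, pairCloseness_eq_half_pow h.not_withinDist (h.withinDist huv),
    pairCloseness_eq_half_pow h.not_withinDist_deleteLink hcut]
  ring

theorem closeness_sub_closeness_deleteLink_le [DecidableEq V] (huv : G.Adj u v)
    (hD : ∀ x y, WithinDist G D x y) (hL : WithinDist (deleteLink G u v) L u v) :
    closeness G - closeness (deleteLink G u v) ≤ 2 * ∑ k ∈ Finset.range D,
      (dependentPairs G u v k).card * ((1 / 2 : ℝ) ^ (k + 1) - (1 / 2) ^ (k + L)) := by
  rw [closeness_sub_closeness_deleteLink, sum_linkLoss_eq huv hD]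
  gcongr with k _
  rw [← nsmul_eq_mul]
  exact Finset.sum_le_card_nsmul _ _ _ fun q hq => linkLoss_le hL hq

theorem closeness_sub_closeness_deleteLink_eq [DecidableEq V] (huv : G.Adj u v)
    (hD : ∀ x y, WithinDist G D x y) (hL : WithinDist (deleteLink G u v) 2 u v) :
    closeness G - closeness (deleteLink G u v) =
      2 * ∑ k ∈ Finset.range D, (dependentPairs G u v k).card * (1 / 2 : ℝ) ^ (k + 2) := by
  rw [closeness_sub_closeness_deleteLink, sum_linkLoss_eq huv hD]
  congr! 2 with k _
  rw [Finset.sum_congr rfl fun q hq => linkLoss_eq huv hL hq, Finset.sum_const, nsmul_eq_mul]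

end Fintype

end LinkLoss

section CirclePoint

variable {n : ℕ} {z w s : ℤ}

/-- The vertex of the circle on `2 * n + 1` points at the integer position `z`, counted from the
vertex with label `1` and taken modulo `2 * n + 1`. -/
def circlePoint (n : ℕ) (z : ℤ) : Fin (2 * n + 1) :=
  ⟨(z % (2 * n + 1)).toNat,
    (Int.toNat_lt' (by omega)).mpr (by exact_mod_cast Int.emod_lt_of_pos z (by omega))⟩

theorem circlePoint_val (n : ℕ) (z : ℤ) : ((circlePoint n z).val : ℤ) = z % (2 * n + 1) :=
  Int.toNat_of_nonneg (Int.emod_nonneg z (by omega))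

theorem circlePoint_val_of_mem (h₀ : 0 ≤ z) (h₁ : z ≤ 2 * n) : ((circlePoint n z).val : ℤ) = z := by
  rw [circlePoint_val]
  exact Int.emod_eq_of_lt h₀ (by omega)

theorem circlePoint_coe (x : Fin (2 * n + 1)) : circlePoint n (x.val : ℤ) = x :=
  Fin.ext (by exact_mod_cast circlePoint_val_of_mem (n := n) (z := x.val) (by omega) (by omega))

theorem circlePoint_eq_iff : circlePoint n z = circlePoint n w ↔ (2 * n + 1 : ℤ) ∣ w - z := by
  rw [Fin.ext_iff, ← Int.natCast_inj, circlePoint_val, circlePoint_val]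
  exact Int.modEq_iff_dvd

theorem circlePoint_congr (c : ℤ) (h : w - z = (2 * n + 1) * c) :
    circlePoint n z = circlePoint n w :=
  circlePoint_eq_iff.mpr ⟨c, h⟩

theorem circlePoint_add_congr (h : circlePoint n z = circlePoint n w) (s : ℤ) :
    circlePoint n (z + s) = circlePoint n (w + s) := by
  rw [circlePoint_eq_iff] at h ⊢
  simpa using h

theorem eq_of_circlePoint_eq (h : circlePoint n z = circlePoint n w) (h₁ : z < w + (2 * n + 1))
    (h₂ : w < z + (2 * n + 1)) : z = w := by
  have := Int.eq_zero_of_abs_lt_dvd (circlePoint_eq_iff.mp h) (abs_lt.mpr ⟨by omega, by omega⟩)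
  omega

theorem exists_circlePoint_add_eq (z : ℤ) (y : Fin (2 * n + 1)) :
    ∃ s : ℤ, -n ≤ s ∧ s ≤ n ∧ y = circlePoint n (z + s) := by
  have hlo := Int.le_bmod (x := y.val - z) (m := 2 * n + 1) (by omega)
  have hhi := Int.bmod_lt (x := y.val - z) (m := 2 * n + 1) (by omega)
  refine ⟨Int.bmod (y.val - z) (2 * n + 1), by omega, by omega, ?_⟩
  conv_lhs => rw [← circlePoint_coe y]
  obtain ⟨c, hc⟩ := Int.dvd_bmod_sub_self (x := (y.val : ℤ) - z) (m := 2 * n + 1)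
  exact circlePoint_congr c (by push_cast at hc; omega)

theorem circlePoint_val_add (h₀ : 0 ≤ s) (h₁ : s < 2 * n + 1) :
    ((circlePoint n (z + s)).val : ℤ) = (circlePoint n z).val + s ∨
    ((circlePoint n (z + s)).val : ℤ) = (circlePoint n z).val + s - (2 * n + 1) := by
  have hval : ((circlePoint n (z + s)).val : ℤ) = ((circlePoint n z).val + s) % (2 * n + 1) := by
    rw [circlePoint_val, circlePoint_val, Int.emod_add_emod]
  rw [hval]
  rcases lt_or_ge ((circlePoint n z).val + s) (2 * n + 1) with h | h
  · exact Or.inl (Int.emod_eq_of_lt (by omega) h)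
  · right
    rw [← Int.sub_emod_right]
    exact Int.emod_eq_of_lt (by omega) (by omega)

theorem rev_circlePoint (n : ℕ) (z : ℤ) : (circlePoint n z).rev = circlePoint n (2 * n - z) := by
  have hdvd : (2 * n + 1 : ℤ) ∣ z - (circlePoint n z).val := by
    rw [circlePoint_val]
    exact Int.dvd_self_sub_emod
  obtain ⟨c, hc⟩ := hdvd
  rw [← circlePoint_coe (circlePoint n z).rev, Fin.val_rev]
  exact circlePoint_congr (-c) (by rw [mul_neg, ← hc]; omega)

theorem circleDist_circlePoint_add (h₀ : 0 ≤ s) (h₁ : s ≤ n) :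
    (circleDist (circlePoint n z) (circlePoint n (z + s)) : ℤ) = s := by
  have hval := circlePoint_val_add (n := n) (z := z) h₀ (by omega)
  simp only [circleDist, vertexLabel, Nat.dist]
  omega

end CirclePoint

section Harary

theorem hararyGraph_adj_rev {k N : ℕ} {x y : Fin N} :
    (hararyGraph k N).Adj x.rev y.rev ↔ (hararyGraph k N).Adj x y := by
  have hdist : circleDist x.rev y.rev = circleDist x y := by
    simp only [circleDist, vertexLabel, Nat.dist, Fin.val_rev]
    omega
  have hlabel (x y : Fin N) :
      vertexLabel x.rev + N / 2 = vertexLabel y.rev ↔ vertexLabel y + N / 2 = vertexLabel x := by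
    simp only [vertexLabel, Fin.val_rev]
    omega
  simp only [hararyGraph, hdist, hlabel, ne_eq, Fin.rev_inj]
  tauto

/-- The reflection of the circle `1, …, N` that exchanges the vertices `i` and `N + 1 - i`, as an
automorphism of the Harary graph. -/
def hararyReflection (k N : ℕ) : hararyGraph k N ≃g hararyGraph k N where
  toEquiv := Fin.revPerm
  map_rel_iff' := hararyGraph_adj_rev

/-- The Harary graph `H_{2m+1,2n+1}`. -/
abbrev oddHarary (m n : ℕ) : SimpleGraph (Fin (2 * n + 1)) := hararyGraph (2 * m + 1) (2 * n + 1)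

/-- `H_{2m+1,2n+1}` without the link that leads `r` steps forward from the position `u`. -/
abbrev cutHarary (m n : ℕ) (u r : ℤ) : SimpleGraph (Fin (2 * n + 1)) :=
  deleteLink (oddHarary m n) (circlePoint n u) (circlePoint n (u + r))

variable {m n : ℕ} {u r z s : ℤ}

theorem oddHarary_adj_add_iff (h₀ : 0 < s) (h₁ : s ≤ n) :
    (oddHarary m n).Adj (circlePoint n z) (circlePoint n (z + s)) ↔
      s ≤ m ∨ s = n ∧ (circlePoint n z).val ≤ n := by
  have hne : circlePoint n z ≠ circlePoint n (z + s) := fun h => by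
    have := eq_of_circlePoint_eq h (by omega) (by omega)
    omega
  have hdist := circleDist_circlePoint_add (z := z) h₀.le h₁
  have hval := circlePoint_val_add (n := n) (z := z) h₀.le (by omega)
  have hodd : Odd (2 * m + 1) := odd_two_mul_add_one m
  simp only [hararyGraph, hne, hodd, vertexLabel, ne_eq, not_false_eq_true, true_and]
  omega

theorem oddHarary_adj_cases {y : Fin (2 * n + 1)} (h : (oddHarary m n).Adj (circlePoint n z) y) :
    ∃ s : ℤ, y = circlePoint n (z + s) ∧ ((-m ≤ s ∧ s ≤ m) ∨
      (s = n ∧ (circlePoint n z).val ≤ n) ∨ (s = n + 1 ∧ n ≤ (circlePoint n z).val)) := by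
  obtain ⟨s, h₀, h₁, rfl⟩ := exists_circlePoint_add_eq z y
  rcases lt_trichotomy s 0 with hs | rfl | hs
  · have hback : (oddHarary m n).Adj (circlePoint n (z + s)) (circlePoint n (z + s + -s)) := by
      simpa using h.symm
    rcases (oddHarary_adj_add_iff (by omega) (by omega)).mp hback with h | ⟨h, hval⟩
    · exact ⟨s, rfl, Or.inl ⟨by omega, by omega⟩⟩
    · refine ⟨n + 1, circlePoint_congr 1 (by omega), Or.inr (Or.inr ⟨rfl, ?_⟩)⟩
      have := circlePoint_val_add (n := n) (z := z + s) (s := -s) (by omega) (by omega)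
      rw [add_neg_cancel_right] at this
      omega
  · simp at h
  · exact ⟨s, rfl, ((oddHarary_adj_add_iff hs h₁).mp h).imp (fun h => ⟨by omega, h⟩) Or.inl⟩

theorem exists_link_eq {e : Sym2 (Fin (2 * n + 1))} (he : e ∈ (oddHarary m n).edgeSet) :
    ∃ u r : ℤ, 0 ≤ u ∧ u ≤ 2 * n ∧ 0 < r ∧ r ≤ n ∧
      e = s(circlePoint n u, circlePoint n (u + r)) := by
  induction e with | _ x y
  obtain ⟨s, h₀, h₁, hy⟩ := exists_circlePoint_add_eq (x.val : ℤ) y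
  rw [SimpleGraph.mem_edgeSet] at he
  rcases lt_trichotomy s 0 with hs | rfl | hs
  · refine ⟨y.val, -s, by omega, by omega, by omega, by omega, ?_⟩
    have hx := circlePoint_add_congr ((circlePoint_coe y).trans hy) (-s)
    rw [hx, circlePoint_coe, add_neg_cancel_right, circlePoint_coe, Sym2.eq_swap]
  · rw [add_zero, circlePoint_coe] at hy
    exact absurd hy.symm he.ne
  · exact ⟨x.val, s, by omega, by omega, hs, h₁, by rw [circlePoint_coe, ← hy]⟩

theorem link_eq_link_iff (hs : 0 < s) (hr : 0 < r) (hsr : s + r < 2 * n + 1) :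
    s(circlePoint n z, circlePoint n (z + s)) = s(circlePoint n u, circlePoint n (u + r)) ↔
      circlePoint n z = circlePoint n u ∧ s = r := by
  rw [Sym2.eq_iff]
  constructor
  · rintro (⟨hzu, h⟩ | ⟨hzu, h⟩) <;> rw [circlePoint_add_congr hzu] at h
    · have := eq_of_circlePoint_eq h (by omega) (by omega)
      exact ⟨hzu, by omega⟩
    · have := eq_of_circlePoint_eq h (by omega) (by omega)
      omega
  · rintro ⟨hzu, rfl⟩
    exact Or.inl ⟨hzu, circlePoint_add_congr hzu s⟩

theorem cutHarary_adj_add_iff (h₀ : 0 < s) (h₁ : s ≤ n) (hr₀ : 0 < r) (hr₁ : r ≤ n) :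
    (cutHarary m n u r).Adj (circlePoint n z) (circlePoint n (z + s)) ↔
      (s ≤ m ∨ s = n ∧ (circlePoint n z).val ≤ n) ∧
        ¬ (circlePoint n z = circlePoint n u ∧ s = r) := by
  rw [deleteLink_adj, oddHarary_adj_add_iff h₀ h₁, ne_eq, link_eq_link_iff h₀ hr₀ (by omega)]

end Harary

section Range

/-- The inequalities that say `p = ⌊(n + m - 1) / (2 * m)⌋`, for `m > 1` and `p > 1`. They are
stated over `ℤ`, where the positions on the circle live. -/
structure HararyRange (m n p : ℕ) : Prop where
  two_le_m : (2 : ℤ) ≤ m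
  two_le_p : 2 ≤ p
  lower : 2 * ((p : ℤ) * m) + 1 ≤ n + m
  upper : (n : ℤ) ≤ 2 * ((p : ℤ) * m) + m

variable {a b m n p : ℕ}

theorem natCast_mul_le (m : ℕ) (h : a ≤ p) : (a : ℤ) * m ≤ (p : ℤ) * m := by
  gcongr

theorem natCast_succ_mul (a m : ℕ) : ((a + 1 : ℕ) : ℤ) * m = a * m + m := by
  push_cast
  ring

theorem natCast_add_mul (m : ℕ) (h : a + b = p) : (p : ℤ) * m = a * m + b * m := by
  rw [← h]
  push_cast
  ring

theorem HararyRange.two_mul_le (hR : HararyRange m n p) : 2 * (m : ℤ) ≤ (p : ℤ) * m :=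
  natCast_mul_le m hR.two_le_p

theorem HararyRange.three_mul_lt (hR : HararyRange m n p) : 3 * (m : ℤ) < n := by
  have := hR.two_mul_le
  have := hR.lower
  omega

theorem hararyRange_of_eq_div (hm : 1 < m) (hp : p = (n + m - 1) / (2 * m)) (hp1 : 1 < p) :
    HararyRange m n p := by
  have hlo : p * (2 * m) ≤ n + m - 1 := hp ▸ Nat.div_mul_le_self _ _
  have hhi : n + m - 1 < p * (2 * m) + 2 * m := hp ▸ Nat.lt_div_mul_add (by omega)
  rw [Nat.mul_left_comm] at hlo hhi
  zify at hm hlo hhi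
  exact ⟨by omega, hp1, by omega, by omega⟩

end Range

section Walks

variable {m n p k : ℕ} {u r z w s : ℤ}

theorem withinDist_of_arc {H : SimpleGraph (Fin (2 * n + 1))} (hzw : z ≤ w) (hk : w ≤ z + k * m)
    (hH : ∀ t t', z ≤ t → t < t' → t' ≤ w → t' ≤ t + m →
      H.Adj (circlePoint n t) (circlePoint n t')) :
    WithinDist H k (circlePoint n z) (circlePoint n w) := by
  induction k generalizing z with
  | zero =>
    obtain rfl : z = w := by simp at hk; omega
    exact .refl _ _ _
  | succ k ih =>
    have hkm : 0 ≤ (k : ℤ) * m := by positivity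
    rw [natCast_succ_mul] at hk
    rcases le_or_gt w (z + k * m) with h | h
    · exact (ih hzw h hH).mono (by omega)
    · have hstep := hH z (w - k * m) le_rfl (by omega) (by omega) (by omega)
      have hrest := ih (z := w - k * m) (by omega) (by omega) fun t t' ht => hH t t' (by omega)
      exact ((WithinDist.of_adj hstep).trans hrest).mono (by omega)

theorem oddHarary_withinDist_of_arc (hmn : m ≤ n) (hzw : z ≤ w) (hk : w ≤ z + k * m) :
    WithinDist (oddHarary m n) k (circlePoint n z) (circlePoint n w) := by
  refine withinDist_of_arc hzw hk fun t t' _ htt' _ ht' => ?_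
  rw [← add_sub_cancel t t', oddHarary_adj_add_iff (by omega) (by omega)]
  omega

theorem exists_oddHarary_adj_chord (hn : 0 < n) (z : ℤ) : ∃ c : ℤ, (c = n ∨ c = n + 1) ∧
    (oddHarary m n).Adj (circlePoint n z) (circlePoint n (z + c)) := by
  rcases le_total (circlePoint n z).val n with h | h
  · exact ⟨n, Or.inl rfl, (oddHarary_adj_add_iff (by omega) le_rfl).mpr (Or.inr ⟨rfl, h⟩)⟩
  · have hval := circlePoint_val_add (n := n) (z := z) (s := n + 1) (by omega) (by omega)
    have hback : (oddHarary m n).Adj (circlePoint n (z + (n + 1)))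
        (circlePoint n (z + (n + 1) + n)) :=
      (oddHarary_adj_add_iff (by omega) le_rfl).mpr (Or.inr ⟨rfl, by omega⟩)
    rw [circlePoint_congr (z := z + (n + 1) + n) (w := z) (-1) (by ring)] at hback
    exact ⟨n + 1, Or.inr rfl, hback.symm⟩

theorem oddHarary_ball (hm : 0 < m) (hmn : m ≤ n) {y : Fin (2 * n + 1)}
    (h : WithinDist (oddHarary m n) k (circlePoint n z) y) :
    ∃ s : ℤ, y = circlePoint n (z + s) ∧ ((-(k * m : ℤ) ≤ s ∧ s ≤ k * m) ∨
      (1 ≤ k ∧ (n : ℤ) + m - k * m ≤ s ∧ s ≤ n + 1 + k * m - m)) := by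
  induction k generalizing y with
  | zero => exact ⟨0, by simp [h.eq_of_zero]⟩
  | succ k ih =>
    have hkm : 0 ≤ (k : ℤ) * m := by positivity
    rw [natCast_succ_mul]
    rcases h.cases_last with h | ⟨x, hx, hxy⟩
    · obtain ⟨s, rfl, hs⟩ := ih h
      exact ⟨s, rfl, by omega⟩
    · obtain ⟨s, rfl, hs⟩ := ih hx
      obtain ⟨d, rfl, hd⟩ := oddHarary_adj_cases hxy
      rcases hs with hs | hs
      · exact ⟨s + d, by rw [add_assoc], by omega⟩
      by_cases hdm : d ≤ m
      · exact ⟨s + d, by rw [add_assoc], by omega⟩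
      · exact ⟨s + d - (2 * n + 1), circlePoint_congr (-1) (by ring), by omega⟩

theorem oddHarary_withinDist_add (hR : HararyRange m n p) (z : ℤ) (h₀ : 0 ≤ s) (h₁ : s ≤ n) :
    WithinDist (oddHarary m n) (p + 1) (circlePoint n z) (circlePoint n (z + s)) := by
  have hmn := hR.three_mul_lt
  have hupper := hR.upper
  rcases le_or_gt s (p * m + m) with h | h
  · exact oddHarary_withinDist_of_arc (by omega) (by omega) (by rw [natCast_succ_mul]; omega)
  · obtain ⟨c, hc, hchord⟩ := exists_oddHarary_adj_chord (m := m) (n := n) (by omega) z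
    have harc := oddHarary_withinDist_of_arc (m := m) (n := n) (k := p) (z := z + s) (w := z + c)
      (by omega) (by omega) (by omega)
    exact ((WithinDist.of_adj hchord).trans harc.symm).mono (by omega)

theorem oddHarary_withinDist (hR : HararyRange m n p) (x y : Fin (2 * n + 1)) :
    WithinDist (oddHarary m n) (p + 1) x y := by
  obtain ⟨s, h₀, h₁, rfl⟩ := exists_circlePoint_add_eq (x.val : ℤ) y
  conv in x => rw [← circlePoint_coe x]
  rcases le_total 0 s with hs | hs
  · exact oddHarary_withinDist_add hR _ hs h₁
  · simpa using (oddHarary_withinDist_add hR (x.val + s) (s := -s) (by omega) (by omega)).symm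

theorem cutHarary_adj_circle (hmn : m ≤ n) (hr₀ : 0 < r) (hrn : r ≤ n) (hzw : z < w)
    (hw : w ≤ z + m) (h : circlePoint n z = circlePoint n u → w ≠ z + r) :
    (cutHarary m n u r).Adj (circlePoint n z) (circlePoint n w) := by
  rw [← add_sub_cancel z w, cutHarary_adj_add_iff (by omega) (by omega) hr₀ hrn]
  exact ⟨Or.inl (by omega), fun ⟨hz, _⟩ => h hz (by omega)⟩

theorem cutHarary_adj_chord (hr₀ : 0 < r) (hrn : r ≤ n)
    (hz : (circlePoint n z).val ≤ n) (h : circlePoint n z = circlePoint n u → r ≠ n) :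
    (cutHarary m n u r).Adj (circlePoint n z) (circlePoint n (z + n)) := by
  rw [cutHarary_adj_add_iff (by omega) le_rfl hr₀ hrn]
  exact ⟨Or.inr ⟨rfl, hz⟩, fun ⟨hzu, hr⟩ => h hzu hr.symm⟩

theorem cutHarary_adj_chord' (hr₀ : 0 < r) (hrn : r ≤ n) (hz : n ≤ (circlePoint n z).val)
    (h : circlePoint n (z + (n + 1)) = circlePoint n u → r ≠ n) :
    (cutHarary m n u r).Adj (circlePoint n z) (circlePoint n (z + (n + 1))) := by
  have hval := circlePoint_val_add (n := n) (z := z) (s := n + 1) (by omega) (by omega)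
  have hback := cutHarary_adj_chord (m := m) hr₀ hrn (z := z + (n + 1)) (by omega) h
  rw [circlePoint_congr (z := z + (n + 1) + n) (w := z) (-1) (by ring)] at hback
  exact hback.symm

theorem cutHarary_withinDist_of_arc (hmn : m ≤ n) (hr₀ : 0 < r) (hrn : r ≤ n) (hzw : z ≤ w)
    (hk : w ≤ z + k * m) (hz : u - (2 * n + 1) < z) (hw : w < u + r + (2 * n + 1))
    (hu : z ≤ u → u + r ≤ w → m < r) :
    WithinDist (cutHarary m n u r) k (circlePoint n z) (circlePoint n w) := by
  refine withinDist_of_arc hzw hk fun t t' _ htt' _ ht' => ?_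
  refine cutHarary_adj_circle hmn hr₀ hrn htt' ht' fun htu hr => ?_
  have := eq_of_circlePoint_eq htu (by omega) (by omega)
  omega

theorem cutHarary_withinDist_two (hm : 2 ≤ m) (hmn : m ≤ n) (hr₀ : 0 < r) (hrm : r ≤ m)
    (hzw : z ≤ w) (hw : w < z + 2 * m) :
    WithinDist (cutHarary m n u r) 2 (circlePoint n z) (circlePoint n w) := by
  have hstep {z w : ℤ} (hzw : z < w) (hw : w ≤ z + m)
      (h : circlePoint n z = circlePoint n u → w ≠ z + r) :
      WithinDist (cutHarary m n u r) 1 (circlePoint n z) (circlePoint n w) :=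
    .of_adj (cutHarary_adj_circle hmn hr₀ (by omega) hzw hw h)
  rcases le_or_gt w z with h | h
  · obtain rfl : z = w := by omega
    exact .refl _ _ _
  have hne {z w : ℤ} (hzw : z < w) (hw : w ≤ z + m) (hz : circlePoint n z = circlePoint n u)
      (hw : circlePoint n w = circlePoint n u) : False := by
    have := eq_of_circlePoint_eq (hz.trans hw.symm) (by omega) (by omega)
    omega
  rcases le_or_gt w (z + m) with hw' | hw'
  · by_cases hlink : circlePoint n z = circlePoint n u → w ≠ z + r
    · exact (hstep h hw' hlink).mono one_le_two
    push Not at hlink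
    obtain ⟨hzu, rfl⟩ := hlink
    rcases eq_or_ne r 1 with rfl | hr
    · refine (hstep (w := z + 2) (by omega) (by omega) (by omega)).trans
        (hstep (z := z + 1) (by omega) (by omega) fun h => ?_).symm
      exact (hne (by omega) (by omega) hzu h).elim
    · exact (hstep (w := z + 1) (by omega) (by omega) (by omega)).trans
        (hstep (by omega) (by omega) (by omega))
  by_cases hmid : (circlePoint n z = circlePoint n u → z + m ≠ z + r) ∧
      (circlePoint n (z + m) = circlePoint n u → w ≠ z + m + r)
  · exact (hstep (by omega) le_rfl hmid.1).trans (hstep (by omega) (by omega) hmid.2)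
  · refine (hstep (w := z + (m - 1)) (by omega) (by omega) fun hz hr => hmid ?_).trans
      (hstep (by omega) (by omega) fun hz hr => hmid ?_)
    · exact ⟨fun _ => by omega, fun hz' => (hne (by omega) le_rfl hz hz').elim⟩
    · exact ⟨fun hz' => (hne (by omega) (by omega) hz' hz).elim,
        fun hz' => (hne (by omega) (by omega) hz hz').elim⟩

theorem cutHarary_withinDist_of_lt (hm : 2 ≤ m) (hmn : m ≤ n) (hr₀ : 0 < r) (hrm : r ≤ m)
    (hk : 2 ≤ k) (hkm : k * m ≤ (2 * n : ℤ)) (hzw : z ≤ w) (hw : w < z + k * m) :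
    WithinDist (cutHarary m n u r) k (circlePoint n z) (circlePoint n w) := by
  have hadj {z : ℤ} (h : circlePoint n z = circlePoint n u → (m : ℤ) ≠ r) :
      WithinDist (cutHarary m n u r) 1 (circlePoint n z) (circlePoint n (z + m)) :=
    .of_adj (cutHarary_adj_circle hmn hr₀ (by omega) (by omega) le_rfl (by simpa using h))
  induction k, hk using Nat.le_induction generalizing z w with
  | base => exact cutHarary_withinDist_two hm hmn hr₀ hrm hzw hw
  | succ k hk ih =>
    have hk2 : 2 * (m : ℤ) ≤ k * m := natCast_mul_le m hk
    rw [natCast_succ_mul] at hkm hw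
    rcases lt_or_ge w (z + k * m) with h | h
    · exact (ih (by omega) hzw h).mono (by omega)
    by_cases hz : circlePoint n z = circlePoint n u → (m : ℤ) ≠ r
    · exact ((hadj hz).trans (ih (z := z + m) (by omega) (by omega) (by omega))).mono (by omega)
    · have hlast : circlePoint n (w - m) = circlePoint n u → (m : ℤ) ≠ r := fun hwu _ => by
        push Not at hz
        have := eq_of_circlePoint_eq (hz.1.trans hwu.symm) (by omega) (by omega)
        omega
      have hend := hadj hlast
      rw [sub_add_cancel] at hend
      exact (ih (w := w - m) (by omega) (by omega) (by omega)).trans hend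

end Walks

section CircleLink

variable {m n p k a b : ℕ} {u r : ℤ} {x y : Fin (2 * n + 1)}

theorem LinkDependent.rev
    (h : LinkDependent (oddHarary m n) (circlePoint n u) (circlePoint n (u + r)) a b x y) :
    LinkDependent (oddHarary m n) (circlePoint n (2 * n - u - r))
      (circlePoint n (2 * n - u - r + r)) b a y.rev x.rev := by
  have hmap := ((LinkDependent.map_iso (hararyReflection _ _)).mpr h).swap
  have hφ : ∀ x, hararyReflection (2 * m + 1) (2 * n + 1) x = x.rev := fun _ => rfl
  rw [hφ, hφ, hφ, hφ, rev_circlePoint, rev_circlePoint, ← sub_sub] at hmap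
  rwa [sub_add_cancel]

theorem cutHarary_withinDist_of_adj_chord {s c : ℤ} (hmn : m ≤ n) (hr₀ : 0 < r) (hrn : r ≤ n)
    (hc₀ : n ≤ c) (hc₁ : c ≤ n + 1) (hs₀ : 0 < s) (hs₁ : s ≤ 2 * n + 1) (hcs : r + c ≤ s + k * m)
    (hsc : s ≤ r + c + k * m)
    (hchord : (cutHarary m n u r).Adj (circlePoint n (u + r)) (circlePoint n (u + r + c))) :
    WithinDist (cutHarary m n u r) (k + 1) (circlePoint n (u + s)) (circlePoint n (u + r)) := by
  refine .trans ?_ (.of_adj hchord.symm)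
  rcases le_total s (r + c) with h | h
  · exact cutHarary_withinDist_of_arc hmn hr₀ hrn (by omega) (by omega) (by omega) (by omega)
      (by omega)
  · exact (cutHarary_withinDist_of_arc hmn hr₀ hrn (by omega) (by omega) (by omega) (by omega)
      (by omega)).symm

theorem LinkDependent.near_cases_circle (hR : HararyRange m n p) (hr₀ : 0 < r) (hrm : r ≤ m)
    (hab : a + b ≤ p)
    (h : LinkDependent (oddHarary m n) (circlePoint n u) (circlePoint n (u + r)) a b x y) :
    (x = circlePoint n (u - a * m) ∧ (a = 0 ∨ r = m)) ∨
      (r = m ∧ 1 ≤ a ∧ x = circlePoint n (u + n + m - a * m) ∧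
        n < (circlePoint n (u + r)).val) := by
  have hmn := hR.three_mul_lt
  have hm := hR.two_le_m
  have hlo := hR.lower
  have ham := natCast_mul_le m (show a ≤ p by omega)
  have hsucc := natCast_succ_mul a m
  obtain ⟨s, rfl, hs⟩ := oddHarary_ball (by omega) (by omega)
    (h.near.mono_graph (deleteLink_le _ _ _)).symm
  have hnot := h.not_withinDist_near
  rcases hs with hs | ⟨ha, hs⟩
  · rcases Nat.eq_zero_or_pos a with rfl | ha
    · obtain rfl : s = 0 := by simp at hs; omega
      simp
    by_cases hend : s = -(a * m) ∧ r = m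
    · exact Or.inl ⟨by rw [hend.1, sub_eq_add_neg], Or.inr hend.2⟩
    · refine absurd ?_ hnot
      rcases le_total s r with h | h
      · exact cutHarary_withinDist_of_lt (by omega) (by omega) hr₀ hrm (by omega) (by omega)
          (by omega) (by omega)
      · exact (cutHarary_withinDist_of_lt (by omega) (by omega) hr₀ hrm (by omega) (by omega)
          (by omega) (by omega)).symm
  have hma := natCast_mul_le m ha
  rcases le_or_gt (circlePoint n (u + r)).val n with hv | hv
  · refine absurd (cutHarary_withinDist_of_adj_chord (c := n) (by omega) hr₀ (by omega) le_rfl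
      (by omega) (by omega) (by omega) (by omega) (by omega) ?_) hnot
    exact cutHarary_adj_chord hr₀ (by omega) hv (by omega)
  by_cases hend : r = m ∧ s = n + m - a * m
  · exact Or.inr ⟨hend.1, ha, by rw [hend.2]; congr 1; ring, hv⟩
  · refine absurd (cutHarary_withinDist_of_adj_chord (c := n + 1) (by omega) hr₀ (by omega)
      (by omega) le_rfl (by omega) (by omega) (by omega) (by omega) ?_) hnot
    exact cutHarary_adj_chord' hr₀ (by omega) hv.le (by omega)

theorem LinkDependent.far_cases_circle (hR : HararyRange m n p) (hr₀ : 0 < r) (hrm : r ≤ m)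
    (hab : a + b ≤ p)
    (h : LinkDependent (oddHarary m n) (circlePoint n u) (circlePoint n (u + r)) a b x y) :
    (y = circlePoint n (u + r + b * m) ∧ (b = 0 ∨ r = m)) ∨
      (r = m ∧ 1 ≤ b ∧ y = circlePoint n (u - n + b * m) ∧ (circlePoint n u).val < n) := by
  rcases h.rev.near_cases_circle hR hr₀ hrm (by omega) with ⟨hy, hb⟩ | ⟨rfl, hb, hy, hu⟩
  · refine Or.inl ⟨?_, hb⟩
    rw [← Fin.rev_inj, hy, rev_circlePoint]
    congr 1
    ring
  · refine Or.inr ⟨rfl, hb, ?_, ?_⟩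
    · rw [← Fin.rev_inj, hy, rev_circlePoint]
      congr 1
      ring
    · rw [sub_add_cancel, ← rev_circlePoint, Fin.val_rev] at hu
      omega

theorem LinkDependent.not_chord_chord (hR : HararyRange m n p) (ha : 1 ≤ a) (hb : 1 ≤ b)
    (hx : x = circlePoint n (u + n + m - a * m))
    (hy : y = circlePoint n (u - n + b * m)) {v w : Fin (2 * n + 1)} :
    ¬ LinkDependent (oddHarary m n) v w a b x y := fun h => by
  have hmn := hR.three_mul_lt
  have hm := hR.two_le_m
  have hma := natCast_mul_le m ha
  have hmb := natCast_mul_le m hb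
  have hsum := natCast_add_mul m (a := a) (b := b) rfl
  refine h.not_withinDist ?_
  rw [hx, hy, circlePoint_congr (z := u - n + b * m) (w := u + n + 1 + b * m) 1 (by ring)]
  exact oddHarary_withinDist_of_arc (by omega) (by omega) (by omega)

theorem LinkDependent.add_ne_of_chord_circle (hR : HararyRange m n p) (ha : 1 ≤ a)
    (hx : x = circlePoint n (u + n + m - a * m)) (hy : y = circlePoint n (u + m + b * m))
    (h : LinkDependent (oddHarary m n) (circlePoint n u) (circlePoint n (u + m)) a b x y) :
    a + b ≠ p := fun hab => by
  have hmn := hR.three_mul_lt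
  have hm := hR.two_le_m
  have hlo := hR.lower
  have hup := hR.upper
  have hma := natCast_mul_le m ha
  have hb₀ : 0 ≤ (b : ℤ) * m := by positivity
  have hsum : (p : ℤ) * m = a * m + b * m := natCast_add_mul m hab
  have hsucc := natCast_succ_mul (a + b) m
  rw [hab] at hsucc
  refine h.not_withinDist_deleteLink ?_
  rw [hx, hy, hab]
  exact (cutHarary_withinDist_of_arc (by omega) (by omega) (by omega) (by omega) (by omega)
    (by omega) (by omega) (by omega)).symm

theorem LinkDependent.lt_val_of_circle_circle (hR : HararyRange m n p) (hab : a + b = p)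
    (hx : x = circlePoint n (u - a * m)) (hy : y = circlePoint n (u + m + b * m))
    (h : LinkDependent (oddHarary m n) (circlePoint n u) (circlePoint n (u + m)) a b x y) :
    n < x.val := by
  by_contra! hval
  have hmn := hR.three_mul_lt
  have hm := hR.two_le_m
  have hlo := hR.lower
  have hup := hR.upper
  have ha₀ : 0 ≤ (a : ℤ) * m := by positivity
  have hb₀ : 0 ≤ (b : ℤ) * m := by positivity
  have hsum : (p : ℤ) * m = a * m + b * m := natCast_add_mul m hab
  refine h.not_withinDist_deleteLink ?_
  subst hx hy
  have hchord := cutHarary_adj_chord (m := m) (u := u) (r := m) (by omega) (by omega) hval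
    (by omega)
  have harc := cutHarary_withinDist_of_arc (m := m) (n := n) (k := p) (u := u) (r := m)
    (z := u + m + b * m) (w := u - a * m + n) (by omega) (by omega) (by omega) (by omega)
    (by omega) (by omega) (by omega) (by omega)
  exact ((WithinDist.of_adj hchord).trans harc.symm).mono (by omega)

theorem LinkDependent.val_lt_of_circle_circle (hR : HararyRange m n p) (hab : a + b = p)
    (hx : x = circlePoint n (u - a * m)) (hy : y = circlePoint n (u + m + b * m))
    (h : LinkDependent (oddHarary m n) (circlePoint n u) (circlePoint n (u + m)) a b x y) :
    y.val < n := by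
  have hrev := h.rev.lt_val_of_circle_circle hR (by omega)
    (by rw [hy, rev_circlePoint]; congr 1; ring) (by rw [hx, rev_circlePoint]; congr 1; ring)
  rw [Fin.val_rev] at hrev
  omega

theorem LinkDependent.cases_circle (hR : HararyRange m n p) (hr₀ : 0 < r) (hrm : r ≤ m)
    (hab : a + b ≤ p)
    (h : LinkDependent (oddHarary m n) (circlePoint n u) (circlePoint n (u + r)) a b x y) :
    (x = circlePoint n (u - a * m) ∧ y = circlePoint n (u + r + b * m) ∧ (a + b = 0 ∨ r = m)) ∨
      (a + b < p ∧ 1 ≤ a ∧ n < (circlePoint n (u + r)).val ∧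
        x = circlePoint n (u + n + m - a * m) ∧ y = circlePoint n (u + r + b * m)) ∨
      (a + b < p ∧ 1 ≤ b ∧ (circlePoint n u).val < n ∧
        x = circlePoint n (u - a * m) ∧ y = circlePoint n (u - n + b * m)) := by
  rcases h.near_cases_circle hR hr₀ hrm hab with ⟨hx, ha'⟩ | ⟨rfl, ha, hx, hv⟩ <;>
    rcases h.far_cases_circle hR hr₀ hrm hab with ⟨hy, hb'⟩ | ⟨hr, hb, hy, hu⟩
  · exact Or.inl ⟨hx, hy, by omega⟩
  · subst hr
    refine Or.inr (Or.inr ⟨lt_of_le_of_ne hab ?_, hb, hu, hx, hy⟩)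
    rw [add_comm]
    exact h.rev.add_ne_of_chord_circle hR hb (by rw [hy, rev_circlePoint]; congr 1; ring)
      (by rw [hx, rev_circlePoint]; congr 1; ring)
  · have hne := h.add_ne_of_chord_circle hR ha hx hy
    exact Or.inr (Or.inl ⟨lt_of_le_of_ne hab hne, ha, hv, hx, hy⟩)
  · exact absurd h (LinkDependent.not_chord_chord hR ha hb hx hy)

theorem LinkDependent.circle_of_add_eq (hR : HararyRange m n p) (hr₀ : 0 < r) (hrm : r ≤ m)
    (hab : a + b = p)
    (h : LinkDependent (oddHarary m n) (circlePoint n u) (circlePoint n (u + r)) a b x y) :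
    x = circlePoint n (u - a * m) ∧ y = circlePoint n (u + r + b * m) ∧
      (n < (circlePoint n (u + r)).val → 1 ≤ b) ∧ ((circlePoint n u).val < n → 1 ≤ a) ∧
      ¬ (n < (circlePoint n (u + r)).val ∧ (circlePoint n u).val < n) := by
  have hmn := hR.three_mul_lt
  have hp := hR.two_le_p
  have hlo := hR.lower
  have ham := natCast_mul_le m (show a ≤ p by omega)
  have ha₀ : 0 ≤ (a : ℤ) * m := by positivity
  rcases h.cases_circle hR hr₀ hrm hab.le with ⟨hx, hy, hr⟩ | ⟨_, _⟩ | ⟨_, _⟩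
  · obtain rfl : r = m := by omega
    have hxv := h.lt_val_of_circle_circle hR hab hx hy
    have hyv := h.val_lt_of_circle_circle hR hab hx hy
    refine ⟨hx, hy, fun hv => ?_, fun hu => ?_, ?_⟩
    · by_contra! hb
      obtain rfl : b = 0 := by omega
      simp only [hy, CharP.cast_eq_zero, zero_mul, add_zero] at hyv
      omega
    · by_contra! ha
      obtain rfl : a = 0 := by omega
      simp only [hx, CharP.cast_eq_zero, zero_mul, sub_zero] at hxv
      omega
    · rintro ⟨hv, hu⟩
      have hback := circlePoint_val_add (n := n) (z := u - a * m) ha₀ (by omega)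
      have hstep := circlePoint_val_add (n := n) (z := u) (s := m) (by omega) (by omega)
      rw [sub_add_cancel, ← hx] at hback
      omega
  all_goals omega

end CircleLink

section CircleLoss

variable {m n p k : ℕ} {u r : ℤ}

/-- The pair that lies on the circle `a` steps of length `m` before and `b` steps of length `m`
after the link that leads `r` steps forward from `u`. -/
def circlePair (m n : ℕ) (u r : ℤ) (a b : ℕ) : Fin (2 * n + 1) × Fin (2 * n + 1) :=
  (circlePoint n (u - a * m), circlePoint n (u + r + b * m))

/-- The pair whose first vertex reaches `u` by `a - 1` steps of length `m` to `u + n` and the long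
link from there, and whose second vertex lies `b` steps of length `m` after the link
`(u, u + r)`. -/
def chordCirclePair (m n : ℕ) (u r : ℤ) (a b : ℕ) : Fin (2 * n + 1) × Fin (2 * n + 1) :=
  (circlePoint n (u + n + m - a * m), circlePoint n (u + r + b * m))

/-- The mirror image of `chordCirclePair` for `r = m`: the second vertex is reached from `u + m` by
the long link to `u + m - n` and `b - 1` steps of length `m`. -/
def circleChordPair (m n : ℕ) (u : ℤ) (a b : ℕ) : Fin (2 * n + 1) × Fin (2 * n + 1) :=
  (circlePoint n (u - a * m), circlePoint n (u - n + b * m))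

theorem dependentPairs_circle_subset (hR : HararyRange m n p) (hr₀ : 0 < r) (hrm : r ≤ m)
    (hk : k < p) :
    dependentPairs (oddHarary m n) (circlePoint n u) (circlePoint n (u + r)) k ⊆
      (Finset.range (k + 1)).image (fun a => circlePair m n u r a (k - a)) ∪
      (if n < (circlePoint n (u + r)).val then Finset.Ico 1 (k + 1) else ∅).image
        (fun a => chordCirclePair m n u r a (k - a)) ∪
      (if (circlePoint n u).val < n then Finset.range k else ∅).image
        (fun a => circleChordPair m n u a (k - a)) := by
  rintro ⟨x, y⟩ hxy
  obtain ⟨a, b, rfl, h⟩ := mem_dependentPairs.mp hxy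
  have hb : a + b - a = b := by omega
  simp only [Finset.mem_union, Finset.mem_image]
  rcases h.cases_circle hR hr₀ hrm hk.le with
    ⟨hx, hy, -⟩ | ⟨-, ha, hv, hx, hy⟩ | ⟨-, hb', hu, hx, hy⟩
  · exact Or.inl (Or.inl ⟨a, by simp, by rw [hb, hx, hy, circlePair]⟩)
  · exact Or.inl (Or.inr ⟨a, by simp [hv, ha], by rw [hb, hx, hy, chordCirclePair]⟩)
  · exact Or.inr ⟨a, by simp [hu, Nat.pos_of_ne_zero (by omega : b ≠ 0)],
      by rw [hb, hx, hy, circleChordPair]⟩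

theorem dependentPairs_circle_subset_of_eq (hR : HararyRange m n p) (hr₀ : 0 < r) (hrm : r ≤ m) :
    dependentPairs (oddHarary m n) (circlePoint n u) (circlePoint n (u + r)) p ⊆
      ((Finset.range (p + 1)).filter fun a =>
        (n < (circlePoint n (u + r)).val → a < p) ∧ ((circlePoint n u).val < n → 1 ≤ a) ∧
        ¬ (n < (circlePoint n (u + r)).val ∧ (circlePoint n u).val < n)).image
        (fun a => circlePair m n u r a (p - a)) := by
  rintro ⟨x, y⟩ hxy
  obtain ⟨a, b, hab, h⟩ := mem_dependentPairs.mp hxy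
  obtain ⟨hx, hy, hv, hu, huv⟩ := h.circle_of_add_eq hR hr₀ hrm hab
  have hb : p - a = b := by omega
  refine Finset.mem_image.mpr ⟨a, Finset.mem_filter.mpr ⟨?_, ?_, hu, huv⟩, ?_⟩
  · rw [Finset.mem_range]; omega
  · intro h; have := hv h; omega
  · rw [hb, hx, hy, circlePair]

theorem exists_card_dependentPairs_circle_le (hR : HararyRange m n p) (hr₀ : 0 < r) (hrm : r ≤ m)
    (u : ℤ) : ∃ t c : ℕ, ((t = 0 ∧ c = p + 1) ∨ (t = 1 ∧ c = p) ∨ (t = 2 ∧ c = 0)) ∧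
      (∀ k < p, (dependentPairs (oddHarary m n) (circlePoint n u) (circlePoint n (u + r)) k).card ≤
        k + 1 + t * k) ∧
      (dependentPairs (oddHarary m n) (circlePoint n u) (circlePoint n (u + r)) p).card ≤ c := by
  have hlt := fun k hk => (Finset.card_le_card
    (dependentPairs_circle_subset (u := u) (k := k) hR hr₀ hrm hk)).trans
    ((Finset.card_union_le _ _).trans (add_le_add ((Finset.card_union_le _ _).trans
      (add_le_add Finset.card_image_le Finset.card_image_le)) Finset.card_image_le))
  have heq := (Finset.card_le_card
    (dependentPairs_circle_subset_of_eq (u := u) hR hr₀ hrm)).trans Finset.card_image_le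
  simp only [Finset.card_range] at hlt
  by_cases hv : n < (circlePoint n (u + r)).val <;> by_cases hu : (circlePoint n u).val < n <;>
    simp only [hv, hu, ↓reduceIte, Finset.card_range, Nat.card_Ico, Finset.card_empty,
      true_imp_iff, false_imp_iff, and_true, true_and, and_false, not_true, not_false_eq_true,
      Finset.filter_true, Finset.filter_false, add_zero] at hlt heq
  · exact ⟨2, 0, by simp, fun k hk => (hlt k hk).trans (by omega), heq⟩
  · refine ⟨1, p, by simp, fun k hk => (hlt k hk).trans (by omega), heq.trans ?_⟩
    calc _ ≤ (Finset.range p).card := Finset.card_le_card fun a => by simp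
      _ = p := Finset.card_range p
  · refine ⟨1, p, by simp, fun k hk => (hlt k hk).trans (by omega), heq.trans ?_⟩
    calc _ ≤ (Finset.Ico 1 (p + 1)).card := Finset.card_le_card fun a => by simp; omega
      _ = p := Nat.card_Ico 1 (p + 1)
  · exact ⟨0, p + 1, by simp, fun k hk => (hlt k hk).trans (by omega), heq⟩

end CircleLoss

section Series

variable {p : ℕ}

theorem sum_succ_mul_half_pow (p : ℕ) :
    ∑ k ∈ Finset.range p, ((k : ℝ) + 1) * (1 / 2) ^ (k + 2) = 1 - (p + 2) / 2 * (1 / 2) ^ p := by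
  induction p with
  | zero => norm_num
  | succ p ih => rw [Finset.sum_range_succ, ih, pow_succ, pow_succ]; push_cast; ring

theorem sum_mul_half_pow (p : ℕ) :
    ∑ k ∈ Finset.range p, (k : ℝ) * (1 / 2) ^ (k + 2) = 1 / 2 - (p + 1) / 2 * (1 / 2) ^ p := by
  induction p with
  | zero => norm_num
  | succ p ih => rw [Finset.sum_range_succ, ih, pow_succ, pow_succ]; push_cast; ring

theorem three_halves_mul_add_one_le_two_pow (hp : 2 ≤ p) : 3 / 2 * (p : ℝ) + 1 ≤ 2 ^ p := by
  induction p, hp using Nat.le_induction with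
  | base => norm_num
  | succ p hp ih =>
    have : (2 : ℝ) ≤ p := by exact_mod_cast hp
    rw [pow_succ]
    push_cast
    linarith

theorem sum_succ_add_mul_half_pow (t p : ℕ) :
    ∑ k ∈ Finset.range p, ((k + 1 + t * k : ℕ) : ℝ) * (1 / 2) ^ (k + 2) =
      1 - (p + 2) / 2 * (1 / 2) ^ p + t * (1 / 2 - (p + 1) / 2 * (1 / 2) ^ p) := by
  rw [← sum_succ_mul_half_pow, ← sum_mul_half_pow, Finset.mul_sum, ← Finset.sum_add_distrib]
  refine Finset.sum_congr rfl fun k _ => ?_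
  push_cast
  ring

theorem three_mul_add_four_mul_half_pow_le (hp : 2 ≤ p) :
    (3 * p + 4) * (1 / 2 : ℝ) ^ p ≤ 2 + 2 * (1 / 2) ^ p := by
  have h := three_halves_mul_add_one_le_two_pow hp
  have hone : (2 : ℝ) ^ p * (1 / 2) ^ p = 1 := by rw [← mul_pow]; norm_num
  nlinarith [pow_pos (one_half_pos (α := ℝ)) p]

theorem two_mul_sum_mul_half_pow_le (hp : 2 ≤ p) {t c : ℕ} {N : ℕ → ℕ}
    (htc : (t = 0 ∧ c = p + 1) ∨ (t = 1 ∧ c = p) ∨ (t = 2 ∧ c = 0))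
    (hlt : ∀ k < p, N k ≤ k + 1 + t * k) (heq : N p ≤ c) :
    2 * ∑ k ∈ Finset.range (p + 1), (N k : ℝ) * (1 / 2) ^ (k + 2) ≤
      4 - (3 * p + 4) * (1 / 2 : ℝ) ^ p := by
  have hsum : ∑ k ∈ Finset.range (p + 1), (N k : ℝ) * (1 / 2) ^ (k + 2) ≤
      ∑ k ∈ Finset.range p, ((k + 1 + t * k : ℕ) : ℝ) * (1 / 2) ^ (k + 2) +
        c * (1 / 2) ^ (p + 2) := by
    rw [Finset.sum_range_succ]
    gcongr with k hk
    exact hlt k (Finset.mem_range.mp hk)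
  rw [sum_succ_add_mul_half_pow, pow_add] at hsum
  have hpow := three_mul_add_four_mul_half_pow_le hp
  have hq : 0 ≤ (p : ℝ) * (1 / 2) ^ p := by positivity
  have hp' : 2 * (1 / 2 : ℝ) ^ p ≤ p * (1 / 2) ^ p := by gcongr; exact_mod_cast hp
  rcases htc with ⟨rfl, rfl⟩ | ⟨rfl, rfl⟩ | ⟨rfl, rfl⟩ <;> push_cast at hsum <;> linarith

end Series

section CircleBound

variable {m n p : ℕ} {u r : ℤ}

theorem closeness_sub_closeness_cutHarary_circle_le (hR : HararyRange m n p) (hr₀ : 0 < r)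
    (hrm : r ≤ m) : closeness (oddHarary m n) - closeness (cutHarary m n u r) ≤
      4 - (3 * p + 4) * (1 / 2 : ℝ) ^ p := by
  have hmn := hR.three_mul_lt
  have hm := hR.two_le_m
  have hadj : (oddHarary m n).Adj (circlePoint n u) (circlePoint n (u + r)) :=
    (oddHarary_adj_add_iff hr₀ (by omega)).mpr (Or.inl hrm)
  have hcut : WithinDist (cutHarary m n u r) 2 (circlePoint n u) (circlePoint n (u + r)) :=
    cutHarary_withinDist_two (by omega) (by omega) hr₀ hrm (by omega) (by omega)
  obtain ⟨t, c, htc, hlt, heq⟩ := exists_card_dependentPairs_circle_le hR hr₀ hrm u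
  rw [closeness_sub_closeness_deleteLink_eq hadj (oddHarary_withinDist hR) hcut]
  exact two_mul_sum_mul_half_pow_le hR.two_le_p htc hlt heq

end CircleBound

section ChordLink

variable {m n p k a b : ℕ} {u z w : ℤ} {x y : Fin (2 * n + 1)}

theorem cutHarary_chord_withinDist (hmn : m < n) (hzw : z ≤ w + k * m) (hwz : w ≤ z + k * m) :
    WithinDist (cutHarary m n u n) k (circlePoint n z) (circlePoint n w) := by
  have harc {z w : ℤ} (h : z ≤ w) (hk : w ≤ z + k * m) :
      WithinDist (cutHarary m n u n) k (circlePoint n z) (circlePoint n w) :=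
    withinDist_of_arc h hk fun t t' _ htt' _ ht' =>
      cutHarary_adj_circle hmn.le (by omega) le_rfl htt' ht' (by omega)
  rcases le_total z w with h | h
  · exact harc h hwz
  · exact (harc h hzw).symm

theorem LinkDependent.not_adj_of_chord (hmn : m < n)
    (h : LinkDependent (oddHarary m n) (circlePoint n u) (circlePoint n (u + n)) a b
      (circlePoint n z) y) (hw₀ : w ≤ u + n + a * m) (hw₁ : u + n ≤ w + a * m) :
    ¬ (cutHarary m n u n).Adj (circlePoint n z) (circlePoint n w) := fun hadj =>
  h.not_withinDist_near
    (((WithinDist.of_adj hadj).trans (cutHarary_chord_withinDist hmn hw₀ hw₁)).mono (by omega))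

theorem LinkDependent.near_eq_chord (hR : HararyRange m n p) (hu₀ : 0 ≤ u) (hu₁ : u ≤ n)
    (hab : a + b ≤ p)
    (h : LinkDependent (oddHarary m n) (circlePoint n u) (circlePoint n (u + n)) a b x y) :
    x = circlePoint n (u + a * m) ∧ (a = 0 ∨ n < u + a * m) := by
  have hm := hR.two_le_m
  have hmn := hR.three_mul_lt
  have hlo := hR.lower
  have hval := circlePoint_val_of_mem (n := n) hu₀ (by omega)
  have ham := natCast_mul_le m (show a ≤ p by omega)
  obtain ⟨s, rfl, hs⟩ := oddHarary_ball (by omega) (by omega)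
    (h.near.mono_graph (deleteLink_le _ _ _)).symm
  rcases Nat.eq_zero_or_pos a with rfl | ha
  · obtain rfl : s = 0 := by simp at hs; omega
    simp
  have hma := natCast_mul_le m ha
  rcases hs with hs | ⟨-, hs⟩
  · have hs₀ : s ≠ 0 := by
      rintro rfl
      exact h.ne_of_pos ((oddHarary_adj_add_iff (by omega) le_rfl).mpr
        (Or.inr ⟨rfl, by omega⟩)) ha (by rw [add_zero])
    rcases le_or_gt (circlePoint n (u + s)).val n with hv | hv
    · refine (h.not_adj_of_chord (by omega) (by omega) (by omega)
        (cutHarary_adj_chord (by omega) le_rfl hv fun heq => ?_)).elim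
      have := eq_of_circlePoint_eq heq (by omega) (by omega)
      omega
    by_cases hend : s = a * m
    · subst hend
      have := circlePoint_val_of_mem (n := n) (z := u + a * m) (by omega) (by omega)
      exact ⟨rfl, Or.inr (by omega)⟩
    · refine (h.not_adj_of_chord (by omega) (by omega) (by omega)
        (cutHarary_adj_chord' (by omega) le_rfl hv.le fun heq => ?_)).elim
      have := eq_of_circlePoint_eq heq (by omega) (by omega)
      omega
  · exact absurd ((cutHarary_chord_withinDist (k := a) (by omega) (by omega) (by omega)).mono
      (by omega)) h.not_withinDist_near

theorem LinkDependent.far_eq_chord (hR : HararyRange m n p) (hu₀ : 0 ≤ u) (hu₁ : u ≤ n)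
    (hab : a + b ≤ p)
    (h : LinkDependent (oddHarary m n) (circlePoint n u) (circlePoint n (u + n)) a b x y) :
    y = circlePoint n (u + n - b * m) ∧ (b = 0 ∨ u < b * m) := by
  obtain ⟨hy, hb⟩ := h.rev.near_eq_chord hR (by omega) (by omega) (by omega)
  refine ⟨?_, by omega⟩
  rw [← Fin.rev_inj, hy, rev_circlePoint]
  congr 1
  ring

theorem LinkDependent.cases_chord (hR : HararyRange m n p) (hu₀ : 0 ≤ u) (hu₁ : u ≤ n)
    (hab : a + b = k) (hk : k ≤ p)
    (h : LinkDependent (oddHarary m n) (circlePoint n u) (circlePoint n (u + n)) a b x y) :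
    (x = circlePoint n (u + k * m) ∧ y = circlePoint n (u + n) ∧ (k = 0 ∨ n < u + k * m)) ∨
      (x = circlePoint n u ∧ y = circlePoint n (u + n - k * m) ∧ (k = 0 ∨ u < k * m)) := by
  have hmn := hR.three_mul_lt
  have hlo := hR.lower
  have hkm := natCast_mul_le m hk
  have hsum := natCast_add_mul m hab
  obtain ⟨hx, ha⟩ := h.near_eq_chord hR hu₀ hu₁ (by omega)
  obtain ⟨hy, hb⟩ := h.far_eq_chord hR hu₀ hu₁ (by omega)
  rcases Nat.eq_zero_or_pos b with rfl | hb'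
  · obtain rfl : a = k := by omega
    exact Or.inl ⟨hx, by simpa using hy, ha⟩
  rcases Nat.eq_zero_or_pos a with rfl | ha'
  · obtain rfl : b = k := by omega
    exact Or.inr ⟨by simpa using hx, hy, hb⟩
  · omega

theorem card_dependentPairs_chord_le_two (hR : HararyRange m n p) (hu₀ : 0 ≤ u) (hu₁ : u ≤ n)
    (hk : k ≤ p) :
    (dependentPairs (oddHarary m n) (circlePoint n u) (circlePoint n (u + n)) k).card ≤ 2 := by
  refine (Finset.card_le_card (t := {(circlePoint n (u + k * m), circlePoint n (u + n)),
    (circlePoint n u, circlePoint n (u + n - k * m))}) ?_).trans Finset.card_le_two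
  rintro ⟨x, y⟩ hxy
  obtain ⟨a, b, hab, h⟩ := mem_dependentPairs.mp hxy
  rcases h.cases_chord hR hu₀ hu₁ hab hk with ⟨rfl, rfl, -⟩ | ⟨rfl, rfl, -⟩ <;> simp

theorem card_dependentPairs_chord_le_one (hR : HararyRange m n p) (hu₀ : 0 ≤ u) (hu₁ : u ≤ n)
    (hk : k < p) :
    (dependentPairs (oddHarary m n) (circlePoint n u) (circlePoint n (u + n)) k).card ≤ 1 := by
  have hlo := hR.lower
  have hm := hR.two_le_m
  have hkp := natCast_mul_le m (show k + 1 ≤ p from hk)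
  rw [natCast_succ_mul] at hkp
  rw [Finset.card_le_one]
  rintro ⟨x, y⟩ hxy ⟨x', y'⟩ hxy'
  obtain ⟨a, b, hab, h⟩ := mem_dependentPairs.mp hxy
  obtain ⟨a', b', hab', h'⟩ := mem_dependentPairs.mp hxy'
  rcases h.cases_chord hR hu₀ hu₁ hab hk.le with ⟨rfl, rfl, hc⟩ | ⟨rfl, rfl, hc⟩ <;>
    rcases h'.cases_chord hR hu₀ hu₁ hab' hk.le with ⟨rfl, rfl, hc'⟩ | ⟨rfl, rfl, hc'⟩
  · rfl
  · obtain rfl : k = 0 := by omega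
    simp
  · obtain rfl : k = 0 := by omega
    simp
  · rfl

theorem cutHarary_chord_withinDist_three (hR : HararyRange m n p) (hu₀ : 0 ≤ u) (hu₁ : u ≤ n) :
    WithinDist (cutHarary m n u n) 3 (circlePoint n u) (circlePoint n (u + n)) := by
  have hmn := hR.three_mul_lt
  have hm := hR.two_le_m
  have hthrough {s : ℤ} (hs : s = 1 ∨ s = -1) (h₀ : 0 ≤ u + s) (h₁ : u + s ≤ n) :
      WithinDist (cutHarary m n u n) 3 (circlePoint n u) (circlePoint n (u + n)) := by
    have hval := circlePoint_val_of_mem (n := n) h₀ (by omega)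
    have hchord : (cutHarary m n u n).Adj (circlePoint n (u + s)) (circlePoint n (u + s + n)) :=
      cutHarary_adj_chord (by omega) le_rfl (by omega) fun heq => by
        have := eq_of_circlePoint_eq heq (by omega) (by omega)
        omega
    have hout := cutHarary_chord_withinDist (m := m) (n := n) (u := u) (k := 1) (z := u)
      (w := u + s) (by omega) (by omega) (by omega)
    have hback := cutHarary_chord_withinDist (m := m) (n := n) (u := u) (k := 1) (z := u + s + n)
      (w := u + n) (by omega) (by omega) (by omega)
    exact (hout.trans (.of_adj hchord)).trans hback
  rcases hu₁.lt_or_eq with h | h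
  · exact hthrough (Or.inl rfl) (by omega) (by omega)
  · exact hthrough (Or.inr rfl) (by omega) (by omega)

theorem sum_half_pow_sub (p : ℕ) :
    ∑ k ∈ Finset.range p, ((1 / 2 : ℝ) ^ (k + 1) - (1 / 2) ^ (k + 3)) =
      3 / 4 - 3 / 4 * (1 / 2) ^ p := by
  induction p with
  | zero => norm_num
  | succ p ih => rw [Finset.sum_range_succ, ih, pow_add, pow_add, pow_succ]; ring

theorem closeness_sub_closeness_cutHarary_chord_le (hR : HararyRange m n p) (hu₀ : 0 ≤ u)
    (hu₁ : u ≤ n) : closeness (oddHarary m n) - closeness (cutHarary m n u n) ≤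
      4 - (3 * p + 4) * (1 / 2 : ℝ) ^ p := by
  have hmn := hR.three_mul_lt
  have hval := circlePoint_val_of_mem (n := n) hu₀ (by omega)
  have hadj : (oddHarary m n).Adj (circlePoint n u) (circlePoint n (u + n)) :=
    (oddHarary_adj_add_iff (by omega) le_rfl).mpr (Or.inr ⟨rfl, by omega⟩)
  have hloss := closeness_sub_closeness_deleteLink_le hadj (oddHarary_withinDist hR)
    (cutHarary_chord_withinDist_three hR hu₀ hu₁)
  have hnonneg (k : ℕ) : 0 ≤ (1 / 2 : ℝ) ^ (k + 1) - (1 / 2) ^ (k + 3) :=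
    sub_nonneg.mpr (pow_le_pow_of_le_one (by norm_num) (by norm_num) (by omega))
  have hsum : ∑ k ∈ Finset.range (p + 1), ((dependentPairs (oddHarary m n) (circlePoint n u)
      (circlePoint n (u + n)) k).card : ℝ) * ((1 / 2) ^ (k + 1) - (1 / 2) ^ (k + 3)) ≤
      ∑ k ∈ Finset.range p, ((1 / 2 : ℝ) ^ (k + 1) - (1 / 2) ^ (k + 3)) +
        2 * ((1 / 2) ^ (p + 1) - (1 / 2) ^ (p + 3)) := by
    rw [Finset.sum_range_succ]
    refine add_le_add (Finset.sum_le_sum fun k hk => ?_) ?_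
    · refine mul_le_of_le_one_left (hnonneg k) ?_
      exact_mod_cast card_dependentPairs_chord_le_one hR hu₀ hu₁ (Finset.mem_range.mp hk)
    · refine mul_le_mul_of_nonneg_right ?_ (hnonneg p)
      exact_mod_cast card_dependentPairs_chord_le_two hR hu₀ hu₁ le_rfl
  rw [sum_half_pow_sub, pow_add, pow_add] at hsum
  have hpow := three_mul_add_four_mul_half_pow_le hR.two_le_p
  have hp : (1 / 2 : ℝ) ^ p ≤ (1 / 2) ^ 2 :=
    pow_le_pow_of_le_one (by norm_num) (by norm_num) hR.two_le_p
  linarith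

theorem closeness_sub_closeness_deleteEdges_le (hR : HararyRange m n p) {e : Sym2 (Fin (2 * n + 1))}
    (he : e ∈ (oddHarary m n).edgeSet) :
    closeness (oddHarary m n) - closeness ((oddHarary m n).deleteEdges {e}) ≤
      4 - (3 * p + 4) * (1 / 2 : ℝ) ^ p := by
  obtain ⟨u, r, hu₀, hu₁, hr₀, hrn, rfl⟩ := exists_link_eq he
  rcases (oddHarary_adj_add_iff hr₀ hrn).mp he with hrm | ⟨rfl, hval⟩
  · exact closeness_sub_closeness_cutHarary_circle_le hR hr₀ hrm
  · have := circlePoint_val_of_mem (n := n) hu₀ hu₁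
    exact closeness_sub_closeness_cutHarary_chord_le hR hu₀ (by omega)

end ChordLink

section StraddlingLink

variable {m n p k a b : ℕ} {u : ℤ}

theorem cutHarary_ball (hR : HararyRange m n p) (hu₀ : n < u + m) (hu₁ : u < n) (ha : a < p)
    (hk : k ≤ p) {y : Fin (2 * n + 1)}
    (h : WithinDist (cutHarary m n u m) k (circlePoint n (u - a * m)) y) :
    ∃ s : ℤ, y = circlePoint n (u - a * m + s) ∧
      ((-(k * m : ℤ) ≤ s ∧ s ≤ k * m ∧ (a < k → s < k * m)) ∨
      (1 ≤ k ∧ (n : ℤ) + m - k * m ≤ s ∧ s ≤ n + k * m - m)) := by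
  have hm := hR.two_le_m
  have hlo := hR.lower
  have ham := natCast_mul_le m (show a + 1 ≤ p from ha)
  induction k generalizing y with
  | zero => exact ⟨0, by simp [h.eq_of_zero]⟩
  | succ k ih =>
    have hkm := natCast_mul_le m hk
    have hk₀ : 0 ≤ (k : ℤ) * m := by positivity
    rw [natCast_succ_mul] at ham hkm ⊢
    rcases h.cases_last with h | ⟨x, hx, hxy⟩
    · obtain ⟨s, rfl, hs⟩ := ih (by omega) h
      exact ⟨s, rfl, by omega⟩
    obtain ⟨s, rfl, hs⟩ := ih (by omega) hx
    obtain ⟨hadj, hne⟩ := deleteLink_adj.mp hxy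
    obtain ⟨d, rfl, hd⟩ := oddHarary_adj_cases hadj
    rcases hs with hs | hs
    · refine ⟨s + d, by rw [add_assoc], ?_⟩
      have hlink (hak : a = k) (hs : s = k * m) : d ≠ m := by
        rintro rfl
        rw [hs, hak, sub_add_cancel] at hne
        exact hne rfl
      have hval (hka : k ≤ a) (hs : s = k * m) : (circlePoint n (u - a * m + s)).val < n := by
        have := natCast_mul_le m hka
        have := circlePoint_val_of_mem (n := n) (z := u - a * m + s) (by omega) (by omega)
        omega
      omega
    · by_cases hdm : d ≤ m
      · exact ⟨s + d, by rw [add_assoc], by omega⟩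
      · exact ⟨s + d - (2 * n + 1), circlePoint_congr (-1) (by ring), by omega⟩

theorem circlePair_linkDependent (hR : HararyRange m n p) (hu₀ : n < u + m) (hu₁ : u < n)
    (hab : a + b < p) :
    LinkDependent (oddHarary m n) (circlePoint n u) (circlePoint n (u + m)) a b
      (circlePair m n u m a b).1 (circlePair m n u m a b).2 := by
  have hm := hR.two_le_m
  have hlo := hR.lower
  have hmn := hR.three_mul_lt
  have hk := natCast_mul_le m (show a + b + 1 ≤ p from hab)
  have hsum := natCast_add_mul m (rfl : a + b = a + b)
  have ha : 0 ≤ (a : ℤ) * m := by positivity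
  have hb : 0 ≤ (b : ℤ) * m := by positivity
  rw [natCast_succ_mul] at hk
  refine ⟨?_, ?_, fun h => ?_, fun h => ?_⟩
  · exact cutHarary_withinDist_of_arc (by omega) (by omega) (by omega) (by omega) (by omega)
      (by omega) (by omega) (by omega)
  · exact cutHarary_withinDist_of_arc (by omega) (by omega) (by omega) (by omega) (by omega)
      (by omega) (by omega) (by omega)
  · obtain ⟨s, hs, h⟩ := oddHarary_ball (by omega) (by omega) h
    have := eq_of_circlePoint_eq hs (by omega) (by omega)
    omega
  · obtain ⟨s, hs, h⟩ := cutHarary_ball (k := a + b + 1) hR hu₀ hu₁ (by omega) hab h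
    rw [natCast_succ_mul] at h
    have := eq_of_circlePoint_eq hs (by omega) (by omega)
    omega

theorem cutHarary_chord_trans_arc (hR : HararyRange m n p) (hu₀ : n < u + m) (hu₁ : u < n)
    (hb : b < p) :
    WithinDist (cutHarary m n u m) (b + 1) (circlePoint n (u + m))
      (circlePoint n (u + m + (n + 1) + b * m)) := by
  have hlo := hR.lower
  have hmn := hR.three_mul_lt
  have hbm := natCast_mul_le m (show b + 1 ≤ p from hb)
  rw [natCast_succ_mul] at hbm
  have hval := circlePoint_val_of_mem (n := n) (z := u + m) (by omega) (by omega)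
  have hb₀ : 0 ≤ (b : ℤ) * m := by positivity
  have hchord : (cutHarary m n u m).Adj (circlePoint n (u + m))
      (circlePoint n (u + m + (n + 1))) :=
    cutHarary_adj_chord' (by omega) (by omega) (by omega) (by omega)
  exact ((WithinDist.of_adj hchord).trans (cutHarary_withinDist_of_arc (k := b) (by omega)
    (by omega) (by omega) (by omega) le_rfl (by omega) (by omega) (by omega))).mono (by omega)

theorem circleChordPair_linkDependent (hR : HararyRange m n p) (hu₀ : n < u + m) (hu₁ : u < n)
    (hb : 1 ≤ b) (hab : a + b < p) :
    LinkDependent (oddHarary m n) (circlePoint n u) (circlePoint n (u + m)) a b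
      (circleChordPair m n u a b).1 (circleChordPair m n u a b).2 := by
  have hm := hR.two_le_m
  have hlo := hR.lower
  have hmn := hR.three_mul_lt
  have hk := natCast_mul_le m (show a + b + 1 ≤ p from hab)
  have hsum := natCast_add_mul m (rfl : a + b = a + b)
  have ha : 0 ≤ (a : ℤ) * m := by positivity
  have hbm := natCast_mul_le m hb
  rw [natCast_succ_mul] at hk
  have hwrap : (circleChordPair m n u a b).2 = circlePoint n (u + n + 1 + b * m) :=
    circlePoint_congr 1 (by ring)
  rw [hwrap]
  refine ⟨?_, ?_, fun h => ?_, fun h => ?_⟩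
  · exact cutHarary_withinDist_of_arc (by omega) (by omega) (by omega) (by omega) (by omega)
      (by omega) (by omega) (by omega)
  · obtain ⟨b, rfl⟩ := Nat.exists_eq_add_of_le' hb
    rw [natCast_succ_mul b] at hbm ⊢
    have hfar := cutHarary_chord_trans_arc hR hu₀ hu₁ (b := b) (by omega)
    rwa [show u + m + (n + 1) + b * m = u + n + 1 + (b * m + m) by ring] at hfar
  · obtain ⟨s, hs, h⟩ := oddHarary_ball (by omega) (by omega) h
    have := eq_of_circlePoint_eq hs (by omega) (by omega)
    omega
  · obtain ⟨s, hs, h⟩ := cutHarary_ball (k := a + b + 1) hR hu₀ hu₁ (by omega) hab h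
    rw [natCast_succ_mul] at h
    have := eq_of_circlePoint_eq hs (by omega) (by omega)
    omega

theorem chordCirclePair_linkDependent (hR : HararyRange m n p) (hu₀ : n < u + m) (hu₁ : u < n)
    (ha : 1 ≤ a) (hab : a + b < p) :
    LinkDependent (oddHarary m n) (circlePoint n u) (circlePoint n (u + m)) a b
      (chordCirclePair m n u m a b).1 (chordCirclePair m n u m a b).2 := by
  have hrev := (circleChordPair_linkDependent (u := 2 * n - u - m) hR (by omega) (by omega) ha
    (add_comm a b ▸ hab)).rev
  simp only [circleChordPair, rev_circlePoint] at hrev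
  simp only [chordCirclePair]
  convert hrev using 2 <;> ring

/-- The three families of pairs that depend on the link `(u, u + m)` and are joined through it by
shortest paths with `k` other links, when the vertex with two long links lies strictly between its
ends. -/
def straddlingPairs (m n : ℕ) (u : ℤ) (k : ℕ) : Finset (Fin (2 * n + 1) × Fin (2 * n + 1)) :=
  (Finset.range (k + 1)).image (fun a => circlePair m n u m a (k - a)) ∪
    (Finset.Ico 1 (k + 1)).image (fun a => chordCirclePair m n u m a (k - a)) ∪
    (Finset.range k).image (fun a => circleChordPair m n u a (k - a))

theorem straddlingPairs_subset_dependentPairs (hR : HararyRange m n p) (hu₀ : n < u + m)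
    (hu₁ : u < n) (hk : k < p) : straddlingPairs m n u k ⊆
      dependentPairs (oddHarary m n) (circlePoint n u) (circlePoint n (u + m)) k := by
  simp only [straddlingPairs, Finset.union_subset_iff, Finset.image_subset_iff, Finset.mem_range,
    Finset.mem_Ico]
  refine ⟨⟨fun a ha => ?_, fun a ha => ?_⟩, fun a ha => ?_⟩ <;>
    refine mem_dependentPairs.mpr ⟨a, k - a, by omega, ?_⟩
  · exact circlePair_linkDependent hR hu₀ hu₁ (by omega)
  · exact chordCirclePair_linkDependent hR hu₀ hu₁ ha.1 (by omega)
  · exact circleChordPair_linkDependent hR hu₀ hu₁ (by omega) (by omega)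

theorem eq_of_circlePoint_add_mul_eq (hR : HararyRange m n p) (ha : a ≤ p) (hb : b ≤ p)
    (h : circlePoint n (u + a * m) = circlePoint n (u + b * m)) : a = b := by
  have hlo := hR.lower
  have hmn := hR.three_mul_lt
  have ham := natCast_mul_le m ha
  have hbm := natCast_mul_le m hb
  have ha₀ : 0 ≤ (a : ℤ) * m := by positivity
  have hb₀ : 0 ≤ (b : ℤ) * m := by positivity
  have heq := eq_of_circlePoint_eq h (by omega) (by omega)
  have hm : (m : ℤ) ≠ 0 := by have := hR.two_le_m; omega
  exact_mod_cast mul_right_cancel₀ hm (add_left_cancel heq)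

theorem eq_of_circlePoint_sub_mul_eq (hR : HararyRange m n p) (ha : a ≤ p) (hb : b ≤ p)
    (h : circlePoint n (u - a * m) = circlePoint n (u - b * m)) : a = b := by
  refine eq_of_circlePoint_add_mul_eq (u := 2 * n - u) hR ha hb ?_
  rw [← Fin.rev_inj, rev_circlePoint, rev_circlePoint]
  simpa only [← sub_sub, sub_sub_cancel] using h

theorem disjoint_straddlingPairs (hR : HararyRange m n p) (u : ℤ) (hk : k < p) :
    Disjoint ((Finset.range (k + 1)).image (fun a => circlePair m n u m a (k - a)))
        ((Finset.Ico 1 (k + 1)).image (fun a => chordCirclePair m n u m a (k - a))) ∧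
      Disjoint ((Finset.range (k + 1)).image (fun a => circlePair m n u m a (k - a)) ∪
        (Finset.Ico 1 (k + 1)).image (fun a => chordCirclePair m n u m a (k - a)))
        ((Finset.range k).image (fun a => circleChordPair m n u a (k - a))) := by
  have hlo := hR.lower
  have hmn := hR.three_mul_lt
  have hkm := natCast_mul_le m (show k + 1 ≤ p from hk)
  rw [natCast_succ_mul] at hkm
  have hle {a : ℕ} (ha : a ≤ k) : 0 ≤ (a : ℤ) * m ∧ (a : ℤ) * m ≤ k * m :=
    ⟨by positivity, natCast_mul_le m ha⟩
  rw [Finset.disjoint_union_left]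
  simp only [Finset.disjoint_left, Finset.mem_image, Finset.mem_range, Finset.mem_Ico, not_exists,
    not_and, circlePair, chordCirclePair, circleChordPair]
  refine ⟨?_, ?_, ?_⟩ <;> rintro _ ⟨a, ha, rfl⟩ b hb heq <;>
    obtain ⟨hx, hy⟩ := Prod.mk.inj heq
  · have := eq_of_circlePoint_add_mul_eq hR (by omega) (by omega) hy
    obtain rfl : a = b := by omega
    have := eq_of_circlePoint_eq hx (by omega) (by omega)
    omega
  · obtain rfl := eq_of_circlePoint_sub_mul_eq hR (by omega) (by omega) hx
    have := hle (a := k - b) (by omega)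
    have := eq_of_circlePoint_eq hy (by omega) (by omega)
    omega
  · have := hle (a := a) (by omega)
    have := hle (a := b) (by omega)
    have := eq_of_circlePoint_eq hx (by omega) (by omega)
    omega

theorem card_straddlingPairs (hR : HararyRange m n p) (u : ℤ) (hk : k < p) :
    (straddlingPairs m n u k).card = k + 1 + 2 * k := by
  obtain ⟨hdisj, hdisj'⟩ := disjoint_straddlingPairs hR u hk
  have hinj {z : ℤ} {s : Finset ℕ} (hs : ∀ a ∈ s, a ≤ k) (y : ℕ → Fin (2 * n + 1)) :
      (s.image fun a : ℕ => (circlePoint n (z - a * m), y a)).card = s.card :=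
    Finset.card_image_of_injOn fun a ha b hb h =>
      eq_of_circlePoint_sub_mul_eq hR ((hs a ha).trans hk.le) ((hs b hb).trans hk.le)
        (Prod.ext_iff.mp h).1
  rw [straddlingPairs, Finset.card_union_of_disjoint hdisj', Finset.card_union_of_disjoint hdisj]
  simp only [circlePair, chordCirclePair, circleChordPair]
  rw [hinj (by simp), hinj (by simp), hinj (by grind)]
  simp only [Finset.card_range, Nat.card_Ico]
  omega

theorem le_closeness_sub_closeness_cutHarary (hR : HararyRange m n p) (hu₀ : n < u + m)
    (hu₁ : u < n) : 4 - (3 * p + 4) * (1 / 2 : ℝ) ^ p ≤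
      closeness (oddHarary m n) - closeness (cutHarary m n u m) := by
  have hm := hR.two_le_m
  have hmn := hR.three_mul_lt
  have hadj : (oddHarary m n).Adj (circlePoint n u) (circlePoint n (u + m)) :=
    (oddHarary_adj_add_iff (by omega) (by omega)).mpr (Or.inl le_rfl)
  rw [closeness_sub_closeness_deleteLink_eq hadj (oddHarary_withinDist hR)
    (cutHarary_withinDist_two (by omega) (by omega) (by omega) le_rfl (by omega) (by omega)),
    Finset.sum_range_succ]
  have hcard : ∑ k ∈ Finset.range p, ((k + 1 + 2 * k : ℕ) : ℝ) * (1 / 2) ^ (k + 2) ≤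
      ∑ k ∈ Finset.range p, ((dependentPairs (oddHarary m n) (circlePoint n u)
        (circlePoint n (u + m)) k).card : ℝ) * (1 / 2) ^ (k + 2) := by
    gcongr with k hk
    rw [Finset.mem_range] at hk
    rw [← card_straddlingPairs hR u hk]
    exact Finset.card_le_card (straddlingPairs_subset_dependentPairs hR hu₀ hu₁ hk)
  have hsum := sum_succ_add_mul_half_pow 2 p
  have hlast : 0 ≤ ((dependentPairs (oddHarary m n) (circlePoint n u)
      (circlePoint n (u + m)) p).card : ℝ) * (1 / 2) ^ (p + 2) := by positivity
  push_cast at hsum hcard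
  linarith

end StraddlingLink

theorem theorem8_general (m n p : ℕ) (hm : 1 < m) (hp : p = (n + m - 1) / (2 * m)) (hp1 : 1 < p) :
    linkResidualCloseness (hararyGraph (2 * m + 1) (2 * n + 1)) =
        closeness (hararyGraph (2 * m + 1) (2 * n + 1)) - 4
          + (3 * (p : ℝ) + 4) * (2 : ℝ) ^ (-(p : ℤ)) ∧
      ∃ u v : Fin (2 * n + 1), vertexLabel u = n ∧ vertexLabel v = n + m ∧
        (hararyGraph (2 * m + 1) (2 * n + 1)).Adj u v ∧
        closeness ((hararyGraph (2 * m + 1) (2 * n + 1)).deleteEdges {s(u, v)}) =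
          linkResidualCloseness (hararyGraph (2 * m + 1) (2 * n + 1)) := by
  have hR := hararyRange_of_eq_div hm hp hp1
  have hmn := hR.three_mul_lt
  have hadj : (oddHarary m n).Adj (circlePoint n (n - 1)) (circlePoint n (n - 1 + m)) :=
    (oddHarary_adj_add_iff (by omega) (by omega)).mpr (Or.inl le_rfl)
  have hle := closeness_sub_closeness_deleteEdges_le hR ((oddHarary m n).mem_edgeSet.mpr hadj)
  have hge := le_closeness_sub_closeness_cutHarary (u := n - 1) hR (by omega) (by omega)
  have hmin : linkResidualCloseness (oddHarary m n) = closeness (cutHarary m n (n - 1) m) := by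
    refine IsLeast.csInf_eq ⟨⟨_, hadj, rfl⟩, ?_⟩
    rintro c ⟨e, he, rfl⟩
    have := closeness_sub_closeness_deleteEdges_le hR he
    linarith
  have hu := circlePoint_val_of_mem (n := n) (z := n - 1) (by omega) (by omega)
  have hv := circlePoint_val_of_mem (n := n) (z := n - 1 + m) (by omega) (by omega)
  refine ⟨?_, _, _, ?_, ?_, hadj, hmin.symm⟩
  · have hpow : (2 : ℝ) ^ (-(p : ℤ)) = (1 / 2) ^ p := by simp [zpow_neg]
    rw [hpow]
    exact hmin.trans (by linarith)
  · rw [vertexLabel]; omega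
  · rw [vertexLabel]; omega

/-- The link residual closeness of the odd-odd Harary graphs `H_{2m+1,2n+1}`, `m > 2`, and a link
whose removal attains the minimum. -/
theorem theorem8 (m n p : ℕ) (hm : 2 < m) (hp : p = (n + m - 1) / (2 * m)) (hp1 : 1 < p) :
    linkResidualCloseness (hararyGraph (2 * m + 1) (2 * n + 1)) =
        closeness (hararyGraph (2 * m + 1) (2 * n + 1)) - 4
          + (3 * (p : ℝ) + 4) * (2 : ℝ) ^ (-(p : ℤ)) ∧
      ∃ u v : Fin (2 * n + 1), vertexLabel u = n ∧ vertexLabel v = n + m ∧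
        (hararyGraph (2 * m + 1) (2 * n + 1)).Adj u v ∧
        closeness ((hararyGraph (2 * m + 1) (2 * n + 1)).deleteEdges {s(u, v)}) =
          linkResidualCloseness (hararyGraph (2 * m + 1) (2 * n + 1)) :=
  theorem8_general m n p (by omega) hp hp1
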